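/- Let $X$ be a countable set and $\mathscr I$ an ideal on $X$ (proper, containing all finite subsets of $X$). Let $M_{\mathscr I}$ be the $\sigma$-ideal on $X^\omega$ generated by the sets $M_\phi=\{x\in X^\omega:\ x(n)\in\phi(x\upharpoonright n)\text{ for all but finitely many }n\}$ with $\phi\colon X^{<\omega}\to\mathscr I$, and let $K_{\mathscr I}$ be the $\sigma$-ideal on $X^\omega$ generated by the sets $K_\phi=\{x\in X^\omega:\ x(n)\in\phi(n)\text{ for all but finitely many }n\}$ with $\phi\colon\omega\to\mathscr I$. For a $\sigma$-ideal $\mathcal J$ on a set $Y$, let $\mathrm{non}(\mathcal J)$ be the least size of a subset of $Y$ not in $\mathcal J$, and $\mathrm{cov}(\mathcal J)$ the least size of a subfamily of $\mathcal J$ with union $Y$. Consider the following ideals on countable sets. - $\mathrm{Fin}\otimes\mathrm{Fin}$ is the ideal of those $A\subseteq\omega\times\omega$ for which the vertical section $(A)_m=\{n:(m,n)\in A\}$ is infinite for only finitely many $m$. - The Solecki ideal $\mathcal S$ is the ideal on $\Omega=\{U\subseteq 2^\omega:\ U\text{ clopen of measure }1/2\}$ generated by the subsets of $\Omega$ with non-empty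 intersection, where $2^\omega$ carries the standard product (coin-tossing) measure. - The density zero ideal is $\mathcal Z=\{A\subseteq\omega:\ \lim_{n\to\infty}|A\cap n|/n=0\}$. Let $\mathfrak b$ and $\mathfrak d$ be the bounding and dominating numbers, that is, the least sizes of an unbounded and of a dominating family in $(\omega^\omega,\leq^*)$. Let $\mathcal N$ be the ideal of Lebesgue null sets of reals, and let $\mathrm{cov}_\omega(\mathcal N)$ be the least size of a family $\mathcal A\subseteq\mathcal N$ such that every countable set of reals is included in some member of $\mathcal A$. Let $\mathcal E$ be the $\sigma$-ideal on $2^\omega$ generated by the closed null sets. For $f\in\omega^\omega$ and $\pi\colon\omega^{<\omega}\to\omega$ (a predictor), say that $\pi$ $2$-constantly bounding predicts $f$ if for all but finitely many $i<\omega$ there is $j\in\{i,i+1\}$ with $f(j)\leq\pi(f\upharpoonright j)$. Let $\mathfrak e^{\mathrm{const}}_{\leq}(2)$ be the least size of a family $F\subseteq\omega^\omega$ such that no single predictor $2$-constantly bounding predicts all members of $F$, and let $\mathfrak v^{\mathrm{const}}_{\leq}(2)$ be the least size of a family $\Pi$ of predictors such that every $f\in\omega^\omega$ is $2$-constantly bounding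 predicted by some $\pi\in\Pi$. Then: 1. $\mathrm{non}(M_{\mathrm{Fin}\otimes\mathrm{Fin}})=\mathfrak e^{\mathrm{const}}_{\leq}(2)$ and $\mathrm{cov}(M_{\mathrm{Fin}\otimes\mathrm{Fin}})=\mathfrak v^{\mathrm{const}}_{\leq}(2)$, while $\mathrm{non}(K_{\mathrm{Fin}\otimes\mathrm{Fin}})=\mathfrak b$ and $\mathrm{cov}(K_{\mathrm{Fin}\otimes\mathrm{Fin}})=\mathfrak d$. 2. $\mathrm{non}(M_{\mathcal S})=\mathrm{non}(K_{\mathcal S})=\max\{\mathfrak b,\mathrm{cov}_\omega(\mathcal N)\}$ and $\mathrm{cov}(M_{\mathcal S})=\mathrm{cov}(K_{\mathcal S})=\min\{\mathfrak d,\mathrm{non}(\mathcal N)\}$. 3. $\mathrm{non}(M_{\mathcal Z})=\max\{\mathfrak b,\mathrm{non}(\mathcal E)\}$ and $\mathrm{cov}(M_{\mathcal Z})=\min\{\mathfrak d,\mathrm{cov}(\mathcal E)\}$. -/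

import Mathlib

open Filter Topology MeasureTheory

noncomputable section

namespace IdealInvariants

universe u

/-! ## Ideals and sigma-ideals generated by families of sets -/

/-- The ideal on `X` generated by `G`: all sets covered by finitely many members of `G`. -/
def idealGen {X : Type u} (G : Set (Set X)) : Set (Set X) :=
  {A | ∃ F : Set (Set X), F ⊆ G ∧ F.Finite ∧ A ⊆ ⋃₀ F}

/-- The sigma-ideal on `X` generated by `G`: all sets covered by countably many members of `G`. -/
def sigmaIdealGen {X : Type u} (G : Set (Set X)) : Set (Set X) :=
  {A | ∃ F : Set (Set X), F ⊆ G ∧ F.Countable ∧ A ⊆ ⋃₀ F}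

/-- The uniformity number `non(J)`: the least size of a subset of `X` that is not in `J`. -/
def nonNumber {X : Type u} (J : Set (Set X)) : Cardinal.{u} :=
  sInf {κ | ∃ A : Set X, A ∉ J ∧ Cardinal.mk A = κ}

/-- The covering number `cov(J)`: the least size of a subfamily of `J` whose union is `X`. -/
def covNumber {X : Type u} (J : Set (Set X)) : Cardinal.{u} :=
  sInf {κ | ∃ 𝒜 : Set (Set X), 𝒜 ⊆ J ∧ ⋃₀ 𝒜 = Set.univ ∧ Cardinal.mk 𝒜 = κ}

/-! ## The sigma-ideals `M_I` and `K_I` on `X ^ ω` -/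

/-- The restriction `x ↾ n = ⟨x(0), …, x(n-1)⟩`, as an element of `X ^ {<ω} = List X`. -/
def initSeg {X : Type u} (x : ℕ → X) (n : ℕ) : List X :=
  List.ofFn fun i : Fin n => x i

/-- `M_φ = {x ∈ X ^ ω : x(n) ∈ φ(x ↾ n) for all but finitely many n}`. -/
def millerSet {X : Type u} (φ : List X → Set X) : Set (ℕ → X) :=
  {x | ∀ᶠ n in atTop, x n ∈ φ (initSeg x n)}

/-- The `I`-Miller null ideal `M_I`: the sigma-ideal generated by the sets `M_φ` with
`φ : X ^ {<ω} → I`. -/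
def millerNull {X : Type u} (I : Set (Set X)) : Set (Set (ℕ → X)) :=
  sigmaIdealGen {A | ∃ φ : List X → Set X, (∀ s, φ s ∈ I) ∧ A = millerSet φ}

/-- `K_φ = {x ∈ X ^ ω : x(n) ∈ φ(n) for all but finitely many n}`. -/
def kSet {X : Type u} (φ : ℕ → Set X) : Set (ℕ → X) :=
  {x | ∀ᶠ n in atTop, x n ∈ φ n}

/-- The sigma-ideal `K_I` generated by the sets `K_φ` with `φ : ω → I`. -/
def kIdeal {X : Type u} (I : Set (Set X)) : Set (Set (ℕ → X)) :=
  sigmaIdealGen {A | ∃ φ : ℕ → Set X, (∀ n, φ n ∈ I) ∧ A = kSet φ}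

/-! ## The ideals on countable sets -/

/-- The ideal `Fin` of finite sets of natural numbers. -/
def finIdeal : Set (Set ℕ) :=
  {A | A.Finite}

/-- The Fubini product `I ⊗ J = {A ⊆ X × Y : {x : (A)_x ∉ J} ∈ I}`. -/
def fubiniProduct {X Y : Type u} (I : Set (Set X)) (J : Set (Set Y)) : Set (Set (X × Y)) :=
  {A | {x : X | {y : Y | (x, y) ∈ A} ∉ J} ∈ I}

/-- The ideal `Fin ⊗ Fin` on `ω × ω`. -/
def finFin : Set (Set (ℕ × ℕ)) :=
  fubiniProduct finIdeal finIdeal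

/-- The asymptotic density zero ideal `Z` on `ω`. -/
def densityZero : Set (Set ℕ) :=
  {A | Tendsto (fun n : ℕ => ((A ∩ Set.Iio n).ncard : ℝ) / (n : ℝ)) atTop (𝓝 0)}

/-- The standard (coin-tossing, or Lebesgue) probability measure on the Cantor space
`2 ^ ω = ℕ → Bool`: the product of the uniform measures on `Bool`. -/
def cantorMeasure : Measure (ℕ → Bool) :=
  Measure.infinitePi fun _ : ℕ => (PMF.uniformOfFintype Bool).toMeasure

/-- The countable set `Ω` of clopen subsets of `2 ^ ω` of measure `1/2`. -/
def HalfClopen : Type :=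
  {U : TopologicalSpace.Clopens (ℕ → Bool) // cantorMeasure (U : Set (ℕ → Bool)) = 1 / 2}

/-- The Solecki ideal `S` on `Ω`, generated by the subsets of `Ω` with non-empty intersection. -/
def solecki : Set (Set HalfClopen) :=
  idealGen {A | ∃ y : ℕ → Bool, ∀ U ∈ A, y ∈ U.1}

/-! ## Sigma-ideals of measure-theoretic origin -/

/-- The ideal `N` of Lebesgue null sets of reals. -/
def nullIdeal : Set (Set ℝ) :=
  {A | volume A = 0}

/-- `cov_ω(N)`: the least size of a family of null sets such that every countable set of
reals is included in a member of the family. -/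
def covOmegaNull : Cardinal.{0} :=
  sInf {κ | ∃ 𝒜 : Set (Set ℝ), 𝒜 ⊆ nullIdeal ∧
    (∀ B : Set ℝ, B.Countable → ∃ A ∈ 𝒜, B ⊆ A) ∧ Cardinal.mk 𝒜 = κ}

/-- The sigma-ideal `E` on `2 ^ ω` generated by the closed null sets. -/
def closedNullIdeal : Set (Set (ℕ → Bool)) :=
  sigmaIdealGen {C | IsClosed C ∧ cantorMeasure C = 0}

/-! ## Bounding, dominating, and constant bounding evasion and prediction numbers -/

/-- Eventual domination `f ≤* g`. -/
def EvLE (f g : ℕ → ℕ) : Prop :=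
  ∀ᶠ n in atTop, f n ≤ g n

/-- The bounding number `𝔟`. -/
def boundingNumber : Cardinal.{0} :=
  sInf {κ | ∃ F : Set (ℕ → ℕ), (∀ g : ℕ → ℕ, ∃ f ∈ F, ¬ EvLE f g) ∧ Cardinal.mk F = κ}

/-- The dominating number `𝔡`. -/
def dominatingNumber : Cardinal.{0} :=
  sInf {κ | ∃ F : Set (ℕ → ℕ), (∀ g : ℕ → ℕ, ∃ f ∈ F, EvLE g f) ∧ Cardinal.mk F = κ}

/-- The predictor `π : ω ^ {<ω} → ω` `k`-constantly bounding predicts `f`: for all but finitely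
many `i` there is `j ∈ [i, i + k)` with `f(j) ≤ π(f ↾ j)`. -/
def BoundingPredicts (k : ℕ) (f : ℕ → ℕ) (π : List ℕ → ℕ) : Prop :=
  ∀ᶠ i in atTop, ∃ j : ℕ, i ≤ j ∧ j < i + k ∧ f j ≤ π (initSeg f j)

/-- The constant bounding evasion number `𝔢^const_≤(k)`. -/
def constBoundingEvasion (k : ℕ) : Cardinal.{0} :=
  sInf {κ | ∃ F : Set (ℕ → ℕ),
    (∀ π : List ℕ → ℕ, ∃ f ∈ F, ¬ BoundingPredicts k f π) ∧ Cardinal.mk F = κ}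

/-- The constant bounding prediction number `𝔳^const_≤(k)`. -/
def constBoundingPrediction (k : ℕ) : Cardinal.{0} :=
  sInf {κ | ∃ P : Set (List ℕ → ℕ),
    (∀ f : ℕ → ℕ, ∃ π ∈ P, BoundingPredicts k f π) ∧ Cardinal.mk P = κ}

end IdealInvariants

end

open IdealInvariants

/-! Each generated σ-ideal has a base absorbing countable unions, so its non and cov are the two
norms of a relation "`x` lies in the base set of `φ`" (`norms_sigmaIdealGen`). Most estimates are
then Tukey connections, or two-stage versions of them in which a challenge is a pair (`f`, second
object) with `f` from an unbounded family; for cov, the two objects are chosen one after the other.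
For every proper ideal on a countable set containing the finite sets, 𝔟 ≤ non(K) ≤ non(M) and cov(M)
≤ cov(K) ≤ 𝔡.

What lets `f` work against adaptive `φ` is `exists_evLE_of_eventually_le`: a predictor confines `f`
to a finitely branching tree up to a finite error, hence bounds it by one function. So an unbounded
family escapes every predictor infinitely often.

Fin ⊗ Fin: a member is a finite set of columns together with the region under a graph, so guessing a
pair means bounding its first entry, or its second given the first. This is prediction on windows of
length two. Without adaptivity, an `f` escaping the column bounds on an infinite set turns the graph
bounds into one bound for a monotone `f'`.

Solecki: a member is a family hit by finitely many points, so `φ` uses countably many points. If a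
null set contains them, clopen sets `U k` of measure 1/2 eventually avoid each of them, and `U (f
n)` leaves the Miller set. Conversely, `n` independent random points all miss a given set of measure
1/2 with probability 2⁻ⁿ, and Borel–Cantelli applies.

Density zero: density is measured on dyadic blocks, whose elements are binary words. Concatenating
words turns closed null sets into Miller sets. Conversely, cutting a point into blocks of lengths `f
n`, with `f` escaping a predictor, halves the measure infinitely often and pulls Miller sets back to
members of 𝓔. -/

namespace IdealInvariants

/-! ## Relational systems and Tukey connections -/

/-- The least size of a set of challenges that is not met by a single response. -/
noncomputable def bNum {A B : Type} (R : A → B → Prop) : Cardinal.{0} :=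
  sInf {κ | ∃ F : Set A, (∀ b, ∃ a ∈ F, ¬ R a b) ∧ Cardinal.mk F = κ}

/-- The least size of a set of responses that meets every challenge. -/
noncomputable def dNum {A B : Type} (R : A → B → Prop) : Cardinal.{0} :=
  sInf {κ | ∃ D : Set B, (∀ a, ∃ b ∈ D, R a b) ∧ Cardinal.mk D = κ}

section Relational

variable {A B A' B' : Type} {R : A → B → Prop} {S : A' → B' → Prop}

theorem bNum_le_mk {F : Set A} (hF : ∀ b, ∃ a ∈ F, ¬ R a b) : bNum R ≤ Cardinal.mk F :=
  csInf_le' ⟨F, hF, rfl⟩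

theorem dNum_le_mk {D : Set B} (hD : ∀ a, ∃ b ∈ D, R a b) : dNum R ≤ Cardinal.mk D :=
  csInf_le' ⟨D, hD, rfl⟩

theorem exists_mk_eq_bNum (h : ∀ b, ∃ a, ¬ R a b) :
    ∃ F : Set A, (∀ b, ∃ a ∈ F, ¬ R a b) ∧ Cardinal.mk F = bNum R :=
  csInf_mem (s := {κ | ∃ F : Set A, (∀ b, ∃ a ∈ F, ¬ R a b) ∧ Cardinal.mk F = κ})
    ⟨_, Set.univ, by simpa using h, rfl⟩

theorem exists_mk_eq_dNum (h : ∀ a, ∃ b, R a b) :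
    ∃ D : Set B, (∀ a, ∃ b ∈ D, R a b) ∧ Cardinal.mk D = dNum R :=
  csInf_mem (s := {κ | ∃ D : Set B, (∀ a, ∃ b ∈ D, R a b) ∧ Cardinal.mk D = κ})
    ⟨_, Set.univ, by simpa using h, rfl⟩

theorem exists_of_mk_lt_bNum {F : Set A} (h : Cardinal.mk F < bNum R) : ∃ b, ∀ a ∈ F, R a b := by
  by_contra! hF
  exact (bNum_le_mk hF).not_gt h

theorem exists_of_mk_lt_dNum {D : Set B} (h : Cardinal.mk D < dNum R) : ∃ a, ∀ b ∈ D, ¬ R a b := by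
  by_contra! hD
  exact (dNum_le_mk hD).not_gt h

/-- The image under `φ` of an unbounded set is unbounded, since a response `b` to it would make `ψ
b` a response to the original set. The hypothesis `hR` rules out the value `sInf ∅ = 0` on the
right. -/
theorem bNum_le_of_tukey (φ : A → A') (ψ : B' → B) (h : ∀ a b, S (φ a) b → R a (ψ b))
    (hR : ∀ b, ∃ a, ¬ R a b) : bNum S ≤ bNum R := by
  obtain ⟨F, hF, hc⟩ := exists_mk_eq_bNum hR
  refine le_trans (bNum_le_mk (F := φ '' F) fun b => ?_) (Cardinal.mk_image_le.trans hc.le)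
  obtain ⟨a, ha, hab⟩ := hF (ψ b)
  exact ⟨φ a, ⟨a, ha, rfl⟩, fun hs => hab (h a b hs)⟩

theorem dNum_le_of_tukey (φ : A → A') (ψ : B' → B) (h : ∀ a b, S (φ a) b → R a (ψ b))
    (hS : ∀ a, ∃ b, S a b) : dNum R ≤ dNum S := by
  obtain ⟨D, hD, hc⟩ := exists_mk_eq_dNum hS
  refine le_trans (dNum_le_mk (D := ψ '' D) fun a => ?_) (Cardinal.mk_image_le.trans hc.le)
  obtain ⟨b, hb, hab⟩ := hD (φ a)
  exact ⟨ψ b, ⟨b, hb, rfl⟩, h a b hab⟩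

/-- If some challenge always defeats countably many given responses, then infinitely many responses
are needed to meet all challenges. -/
theorem aleph0_le_dNum [Nonempty A] (h : ∀ b : ℕ → B, ∃ a, ∀ n, ¬ R a (b n))
    (hR : ∀ a, ∃ b, R a b) : Cardinal.aleph0 ≤ dNum R := by
  obtain ⟨D, hD, hc⟩ := exists_mk_eq_dNum hR
  rw [← hc]
  by_contra! hlt
  have hne : D.Nonempty := (hD (Classical.arbitrary A)).imp fun _ => And.left
  obtain ⟨b, rfl⟩ := (Cardinal.lt_aleph0_iff_set_finite.1 hlt).countable.exists_eq_range hne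
  obtain ⟨a, ha⟩ := h b
  obtain ⟨_, ⟨n, rfl⟩, hn⟩ := hD a
  exact ha n hn

theorem aleph0_le_bNum [Nonempty B] (h : ∀ a : ℕ → A, ∃ b, ∀ n, R (a n) b)
    (hR : ∀ b, ∃ a, ¬ R a b) : Cardinal.aleph0 ≤ bNum R := by
  obtain ⟨F, hF, hc⟩ := exists_mk_eq_bNum hR
  rw [← hc]
  by_contra! hlt
  have hne : F.Nonempty := (hF (Classical.arbitrary B)).imp fun _ => And.left
  obtain ⟨a, rfl⟩ := (Cardinal.lt_aleph0_iff_set_finite.1 hlt).countable.exists_eq_range hne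
  obtain ⟨b, hb⟩ := h a
  obtain ⟨_, ⟨n, rfl⟩, hn⟩ := hF b
  exact hn (hb n)

end Relational

/-! ## Initial segments -/

section InitSeg

variable {X Y : Type}

@[simp] theorem length_initSeg (x : ℕ → X) (n : ℕ) : (initSeg x n).length = n := by
  simp [initSeg]

@[simp] theorem initSeg_zero (x : ℕ → X) : initSeg x 0 = [] := by
  simp [initSeg]

theorem initSeg_succ (x : ℕ → X) (n : ℕ) : initSeg x (n + 1) = initSeg x n ++ [x n] := by
  simp only [initSeg, List.ofFn_succ_last, Fin.val_castSucc, Fin.val_last]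

theorem initSeg_succ' (x : ℕ → X) (n : ℕ) :
    initSeg x (n + 1) = x 0 :: initSeg (fun i => x (i + 1)) n := by
  simp [initSeg, List.ofFn_succ]

theorem map_initSeg (g : X → Y) (x : ℕ → X) (n : ℕ) :
    (initSeg x n).map g = initSeg (fun i => g (x i)) n := by
  simp [initSeg, List.map_ofFn, Function.comp_def]

theorem getD_initSeg {x : ℕ → X} {n i : ℕ} (h : i < n) (d : X) : (initSeg x n).getD i d = x i := by
  simp [initSeg, List.getD, h]

theorem initSeg_congr {x y : ℕ → X} {n : ℕ} (h : ∀ i < n, x i = y i) :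
    initSeg x n = initSeg y n := by
  simp only [initSeg]
  congr 1
  ext i
  exact h i i.2

theorem exists_forall_initSeg_notMem {φ : List X → Set X} (h : ∀ s, φ s ≠ Set.univ) :
    ∃ x : ℕ → X, ∀ n, x n ∉ φ (initSeg x n) := by
  have h' : ∀ s, ∃ a, a ∉ φ s := fun s => (Set.ne_univ_iff_exists_notMem _).1 (h s)
  choose c hc using h'
  let L : ℕ → List X := fun n => Nat.rec [] (fun _ l => l ++ [c l]) n
  have hL : ∀ n, initSeg (fun n => c (L n)) n = L n := by
    intro n
    induction n with
    | zero => simp [L]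
    | succ n ih => rw [initSeg_succ, ih]
  exact ⟨fun n => c (L n), fun n => by rw [hL]; exact hc _⟩

end InitSeg

/-! ## Bounding predictors and eventual domination -/

/-- The lists obtained by `n` extensions with entries bounded by `max c (π s)` at the node `s`. -/
noncomputable def boundedLists (π : List ℕ → ℕ) (c : ℕ) : ℕ → Finset (List ℕ)
  | 0 => {[]}
  | n + 1 => (boundedLists π c n).biUnion fun s =>
      (Finset.range (max c (π s) + 1)).image fun k => s ++ [k]

theorem initSeg_mem_boundedLists {π : List ℕ → ℕ} {c : ℕ} {f : ℕ → ℕ}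
    (h : ∀ n, f n ≤ max c (π (initSeg f n))) (n : ℕ) : initSeg f n ∈ boundedLists π c n := by
  induction n with
  | zero => simp [boundedLists]
  | succ n ih =>
    simp only [boundedLists, Finset.mem_biUnion, Finset.mem_image, Finset.mem_range]
    exact ⟨_, ih, f n, by have := h n; omega, (initSeg_succ f n).symm⟩

/-- Bounding predictors are no stronger than plain bounds. -/
theorem exists_evLE_of_eventually_le (π : List ℕ → ℕ) :
    ∃ g : ℕ → ℕ, ∀ f : ℕ → ℕ, (∀ᶠ n in atTop, f n ≤ π (initSeg f n)) → EvLE f g := by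
  -- For fixed `c` only finitely many histories of length `n` are possible, so the inner supremum is
  -- finite. Letting `c` run up to `n` gives one function that works for every `c` from `n = c` on.
  refine ⟨fun n => (Finset.range (n + 1)).sup fun c =>
    (boundedLists π c n).sup fun s => max c (π s), fun f hf => ?_⟩
  obtain ⟨N, hN⟩ := eventually_atTop.1 hf
  -- The constant `c` absorbs the finitely many places where the prediction fails.
  let c := (Finset.range N).sup f
  have hc : ∀ n, f n ≤ max c (π (initSeg f n)) := by
    intro n
    rcases lt_or_ge n N with h | h
    · exact le_max_of_le_left (Finset.le_sup (f := f) (Finset.mem_range.2 h))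
    · exact le_max_of_le_right (hN n h)
  refine eventually_atTop.2 ⟨c, fun n hn => (hc n).trans ?_⟩
  have h1 : max c (π (initSeg f n)) ≤ (boundedLists π c n).sup fun s => max c (π s) :=
    Finset.le_sup (f := fun s => max c (π s)) (initSeg_mem_boundedLists hc n)
  exact h1.trans (Finset.le_sup (f := fun c => (boundedLists π c n).sup fun s => max c (π s))
    (Finset.mem_range.2 (by omega)))

theorem boundingNumber_eq : boundingNumber = bNum EvLE := rfl

theorem exists_not_evLE (g : ℕ → ℕ) : ∃ f, ¬ EvLE f g :=
  ⟨fun n => g n + 1, fun h => by obtain ⟨n, hn⟩ := h.exists; simp at hn⟩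

theorem exists_evLE (f : ℕ → ℕ) : ∃ g, EvLE f g :=
  ⟨f, Eventually.of_forall fun _ => le_rfl⟩

theorem exists_forall_evLE (f : ℕ → ℕ → ℕ) : ∃ g, ∀ k, EvLE (f k) g :=
  ⟨fun n => (Finset.range (n + 1)).sup fun k => f k n, fun k => eventually_atTop.2 ⟨k, fun n hn =>
    Finset.le_sup (f := fun k => f k n) (Finset.mem_range.2 (by omega))⟩⟩

theorem aleph0_le_boundingNumber : Cardinal.aleph0 ≤ boundingNumber :=
  aleph0_le_bNum (R := EvLE) exists_forall_evLE exists_not_evLE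

/-- There is an unbounded family of size `𝔟`, and it escapes every bounding predictor. -/
theorem exists_escaping_family : ∃ F : Set (ℕ → ℕ), Cardinal.mk F = boundingNumber ∧
    ∀ π : List ℕ → ℕ, ∃ f ∈ F, ∃ᶠ n in atTop, π (initSeg f n) < f n := by
  obtain ⟨F, hF, hc⟩ := exists_mk_eq_bNum exists_not_evLE
  refine ⟨F, hc, fun π => ?_⟩
  obtain ⟨g, hg⟩ := exists_evLE_of_eventually_le π
  obtain ⟨f, hf, hfg⟩ := hF g
  exact ⟨f, hf, fun h => hfg (hg f (by simpa using h))⟩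

/-- Fewer than `𝔡` bounding predictors are escaped by a single function. -/
theorem exists_escaping_of_mk_lt {ι : Type} (π : ι → List ℕ → ℕ)
    (h : Cardinal.mk ι < dominatingNumber) :
    ∃ f : ℕ → ℕ, ∀ i, ∃ᶠ n in atTop, π i (initSeg f n) < f n := by
  choose g hg using fun i => exists_evLE_of_eventually_le (π i)
  obtain ⟨f, hf⟩ := exists_of_mk_lt_dNum (R := EvLE) (D := Set.range g)
    (Cardinal.mk_range_le.trans_lt h)
  exact ⟨f, fun i hi => hf _ ⟨i, rfl⟩ (hg i f (by simpa using hi))⟩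

/-! ## Uniformity and covering numbers as relational norms -/

theorem covNumber_eq_dNum {X : Type} (J : Set (Set X)) :
    covNumber J = dNum fun (x : X) (A : J) => x ∈ A.1 := by
  unfold covNumber dNum
  congr 1
  ext κ
  constructor
  · rintro ⟨𝒜, h𝒜, hU, rfl⟩
    refine ⟨Subtype.val ⁻¹' 𝒜, fun x => ?_, ?_⟩
    · obtain ⟨A, hA, hx⟩ := Set.mem_sUnion.1 (hU ▸ Set.mem_univ x)
      exact ⟨⟨A, h𝒜 hA⟩, hA, hx⟩
    · exact Cardinal.mk_preimage_of_injective_of_subset_range _ _ Subtype.val_injective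
        (by simpa using h𝒜)
  · rintro ⟨D, hD, rfl⟩
    refine ⟨Subtype.val '' D, by rintro _ ⟨A, -, rfl⟩; exact A.2, ?_,
      Cardinal.mk_image_eq Subtype.val_injective⟩
    refine Set.eq_univ_of_forall fun x => ?_
    obtain ⟨A, hA, hx⟩ := hD x
    exact ⟨A, ⟨A, hA, rfl⟩, hx⟩

/-- Downward closure makes "not in `J`" the same as "not contained in any member of `J`". -/
theorem nonNumber_eq_bNum {X : Type} {J : Set (Set X)} (hJ : ∀ A ∈ J, ∀ B ⊆ A, B ∈ J) :
    nonNumber J = bNum fun (x : X) (A : J) => x ∈ A.1 := by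
  unfold nonNumber bNum
  congr 1
  ext κ
  refine exists_congr fun F => and_congr_left fun _ => ⟨fun h A => ?_, fun h hF => ?_⟩
  · by_contra! hA
    exact h (hJ A.1 A.2 F hA)
  · obtain ⟨a, ha, h'⟩ := h ⟨F, hF⟩
    exact h' ha

theorem sigmaIdealGen_mono {X : Type} {G : Set (Set X)} :
    ∀ A ∈ sigmaIdealGen G, ∀ B ⊆ A, B ∈ sigmaIdealGen G := by
  rintro A ⟨F, hF, hc, hA⟩ B hB
  exact ⟨F, hF, hc, hB.trans hA⟩

theorem mem_sigmaIdealGen {X : Type} {G : Set (Set X)} {A : Set X} (hA : A ∈ G) :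
    A ∈ sigmaIdealGen G :=
  ⟨{A}, by simpa using hA, Set.countable_singleton A, by simp⟩

/-- The norms of a sigma-ideal generated by a family in which countable unions are absorbed. -/
theorem norms_sigmaIdealGen {X B : Type} {G : Set (Set X)} {b : B → Set X}
    (hG : G = Set.range b) [Nonempty B] (hb : ∀ c : ℕ → B, ∃ d, ∀ n, b (c n) ⊆ b d)
    (hne : ∀ d, ∃ x, x ∉ b d) (hcov : ∀ x, ∃ d, x ∈ b d) :
    nonNumber (sigmaIdealGen G) = bNum (fun x d => x ∈ b d) ∧
      covNumber (sigmaIdealGen G) = dNum (fun x d => x ∈ b d) ∧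
      Cardinal.aleph0 ≤ covNumber (sigmaIdealGen G) := by
  -- Every member of the σ-ideal fits inside a single base set, so members and base sets can be
  -- exchanged in both norms.
  have key : ∀ A ∈ sigmaIdealGen G, ∃ d, A ⊆ b d := by
    rintro A ⟨F, hF, hc, hA⟩
    rcases F.eq_empty_or_nonempty with rfl | hFne
    · exact ⟨Classical.arbitrary B, hA.trans (by simp)⟩
    · obtain ⟨e, rfl⟩ := hc.exists_eq_range hFne
      have : ∀ n, ∃ d, b d = e n := fun n => by
        have := hF ⟨n, rfl⟩
        rwa [hG] at this
      choose c hc' using this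
      obtain ⟨d, hd⟩ := hb c
      refine ⟨d, hA.trans ?_⟩
      rw [Set.sUnion_range]
      exact Set.iUnion_subset fun n => hc' n ▸ hd n
  choose! β hβ using key
  have hmem : ∀ d, b d ∈ sigmaIdealGen G := fun d => mem_sigmaIdealGen (hG ▸ ⟨d, rfl⟩)
  have hcov' : covNumber (sigmaIdealGen G) = dNum (fun x d => x ∈ b d) := by
    rw [covNumber_eq_dNum]
    refine le_antisymm
      (dNum_le_of_tukey id (fun d => ⟨b d, hmem d⟩) (fun _ _ h => h) hcov)
      (dNum_le_of_tukey id (fun A => β A) (fun a A h => hβ A A.2 h) fun x => ?_)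
    obtain ⟨d, hd⟩ := hcov x
    exact ⟨⟨b d, hmem d⟩, hd⟩
  refine ⟨?_, hcov', ?_⟩
  · rw [nonNumber_eq_bNum sigmaIdealGen_mono]
    refine le_antisymm
      (bNum_le_of_tukey id (fun A => β A) (fun a A h => hβ A A.2 h) hne)
      (bNum_le_of_tukey id (fun d => ⟨b d, hmem d⟩) (fun _ _ h => h) fun A => ?_)
    obtain ⟨x, hx⟩ := hne (β A)
    exact ⟨x, fun h => hx (hβ A A.2 h)⟩
  · rw [hcov']
    have : Nonempty X := (hne (Classical.arbitrary B)).nonempty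
    refine aleph0_le_dNum (fun c => ?_) hcov
    obtain ⟨d, hd⟩ := hb c
    obtain ⟨x, hx⟩ := hne d
    exact ⟨x, fun n h => hx (hd n h)⟩

/-! ## Miller null sets and their non-adaptive variants -/

/-- A proper ideal containing the finite sets. -/
structure IsProperIdeal {X : Type} (I : Set (Set X)) : Prop where
  subset : ∀ A ∈ I, ∀ B ⊆ A, B ∈ I
  union : ∀ A ∈ I, ∀ B ∈ I, A ∪ B ∈ I
  finite : ∀ A : Set X, A.Finite → A ∈ I
  univ : Set.univ ∉ I

namespace IsProperIdeal

variable {X : Type} {I : Set (Set X)} (hI : IsProperIdeal I)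
include hI

theorem biUnion_le (A : ℕ → Set X) (hA : ∀ n, A n ∈ I) (N : ℕ) : (⋃ n ≤ N, A n) ∈ I := by
  induction N with
  | zero => simpa using hA 0
  | succ N ih =>
    rw [Set.biUnion_le_succ]
    exact hI.union _ ih _ (hA _)

theorem exists_notMem_millerSet (φ : List X → Set X) (hφ : ∀ s, φ s ∈ I) :
    ∃ x, x ∉ millerSet φ := by
  obtain ⟨x, hx⟩ := exists_forall_initSeg_notMem (φ := φ) fun s h => hI.univ (h ▸ hφ s)
  refine ⟨x, fun h => ?_⟩
  obtain ⟨n, hn⟩ := Eventually.exists h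
  exact hx n hn

theorem exists_notMem_kSet (φ : ℕ → Set X) (hφ : ∀ n, φ n ∈ I) : ∃ x, x ∉ kSet φ := by
  obtain ⟨x, hx⟩ := hI.exists_notMem_millerSet (fun s => φ s.length) fun s => hφ _
  exact ⟨x, by simpa [millerSet, kSet] using hx⟩

theorem exists_mem_kSet (x : ℕ → X) : ∃ φ : {φ : ℕ → Set X // ∀ n, φ n ∈ I}, x ∈ kSet φ.1 :=
  ⟨⟨fun n => {x n}, fun _ => hI.finite _ (Set.finite_singleton _)⟩,
    Eventually.of_forall fun _ => rfl⟩

theorem exists_mem_millerSet (x : ℕ → X) :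
    ∃ φ : {φ : List X → Set X // ∀ s, φ s ∈ I}, x ∈ millerSet φ.1 := by
  obtain ⟨φ, hφ⟩ := hI.exists_mem_kSet x
  exact ⟨⟨fun s => φ.1 s.length, fun s => φ.2 _⟩, by simpa [millerSet, kSet] using hφ⟩

/-- At a node of length `n` only the maps with index at most `n` are united: a finite union stays in
`I`, and each index is included from some level on. -/
theorem exists_millerSet_absorbing (c : ℕ → {φ : List X → Set X // ∀ s, φ s ∈ I}) :
    ∃ φ : {φ : List X → Set X // ∀ s, φ s ∈ I}, ∀ k, millerSet (c k).1 ⊆ millerSet φ.1 := by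
  refine ⟨⟨fun s => ⋃ k ≤ s.length, (c k).1 s, fun s => hI.biUnion_le _ (fun k => (c k).2 s) _⟩,
    fun k x hx => ?_⟩
  filter_upwards [hx, eventually_ge_atTop k] with n hn hk
  simp only [Set.mem_iUnion, length_initSeg]
  exact ⟨k, hk, hn⟩

theorem norms_millerNull :
    nonNumber (millerNull I) =
        bNum (fun x (φ : {φ : List X → Set X // ∀ s, φ s ∈ I}) => x ∈ millerSet φ.1) ∧
      covNumber (millerNull I) =
        dNum (fun x (φ : {φ : List X → Set X // ∀ s, φ s ∈ I}) => x ∈ millerSet φ.1) ∧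
      Cardinal.aleph0 ≤ covNumber (millerNull I) := by
  have : Nonempty {φ : List X → Set X // ∀ s, φ s ∈ I} :=
    ⟨⟨fun _ => ∅, fun _ => hI.finite _ Set.finite_empty⟩⟩
  refine norms_sigmaIdealGen (b := fun φ : {φ : List X → Set X // ∀ s, φ s ∈ I} => millerSet φ.1)
    ?_ hI.exists_millerSet_absorbing (fun φ => hI.exists_notMem_millerSet φ.1 φ.2)
    hI.exists_mem_millerSet
  ext A
  exact ⟨fun ⟨φ, h, e⟩ => ⟨⟨φ, h⟩, e.symm⟩, fun ⟨φ, e⟩ => ⟨φ.1, φ.2, e.symm⟩⟩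

theorem norms_kIdeal :
    nonNumber (kIdeal I) =
        bNum (fun x (φ : {φ : ℕ → Set X // ∀ n, φ n ∈ I}) => x ∈ kSet φ.1) ∧
      covNumber (kIdeal I) =
        dNum (fun x (φ : {φ : ℕ → Set X // ∀ n, φ n ∈ I}) => x ∈ kSet φ.1) := by
  have : Nonempty {φ : ℕ → Set X // ∀ n, φ n ∈ I} :=
    ⟨⟨fun _ => ∅, fun _ => hI.finite _ Set.finite_empty⟩⟩
  have h := norms_sigmaIdealGen
    (G := {A | ∃ φ : ℕ → Set X, (∀ n, φ n ∈ I) ∧ A = kSet φ})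
    (b := fun φ : {φ : ℕ → Set X // ∀ n, φ n ∈ I} => kSet φ.1)
    ?_ (fun c => ?_) (fun φ => hI.exists_notMem_kSet φ.1 φ.2) hI.exists_mem_kSet
  · exact ⟨h.1, h.2.1⟩
  · ext A
    exact ⟨fun ⟨φ, h, e⟩ => ⟨⟨φ, h⟩, e.symm⟩, fun ⟨φ, e⟩ => ⟨φ.1, φ.2, e.symm⟩⟩
  · refine ⟨⟨fun n => ⋃ k ≤ n, (c k).1 n, fun n => hI.biUnion_le _ (fun k => (c k).2 n) _⟩,
      fun k x hx => ?_⟩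
    filter_upwards [hx, eventually_ge_atTop k] with n hn hk
    simp only [Set.mem_iUnion]
    exact ⟨k, hk, hn⟩

theorem nonNumber_kIdeal_le : nonNumber (kIdeal I) ≤ nonNumber (millerNull I) := by
  rw [hI.norms_kIdeal.1, hI.norms_millerNull.1]
  exact bNum_le_of_tukey id (fun φ => ⟨fun s => φ.1 s.length, fun s => φ.2 _⟩)
    (fun x φ h => by simpa [millerSet, kSet] using h)
    fun φ => hI.exists_notMem_millerSet φ.1 φ.2

theorem covNumber_millerNull_le : covNumber (millerNull I) ≤ covNumber (kIdeal I) := by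
  rw [hI.norms_kIdeal.2, hI.norms_millerNull.2.1]
  exact dNum_le_of_tukey id (fun φ => ⟨fun s => φ.1 s.length, fun s => φ.2 _⟩)
    (fun x φ h => by simpa [millerSet, kSet] using h) hI.exists_mem_kSet

omit hI in
theorem finite_preimage_Iic {e : X → ℕ} (he : Function.Injective e) (n : ℕ) :
    {a | e a ≤ n}.Finite :=
  (Set.finite_Iic n).preimage he.injOn

/-- A bound on the codes of the entries of `x` confines each entry to a finite set, and finite sets
belong to `I`. -/
theorem boundingNumber_le [Countable X] : boundingNumber ≤ nonNumber (kIdeal I) := by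
  obtain ⟨e, he⟩ := exists_injective_nat X
  rw [hI.norms_kIdeal.1]
  exact bNum_le_of_tukey (S := EvLE) (fun x n => e (x n))
    (fun g => ⟨fun n => {a | e a ≤ g n}, fun n => hI.finite _ (finite_preimage_Iic he _)⟩)
    (fun _ _ h => h) fun φ => hI.exists_notMem_kSet φ.1 φ.2

theorem covNumber_le_dominatingNumber [Countable X] :
    covNumber (kIdeal I) ≤ dominatingNumber := by
  obtain ⟨e, he⟩ := exists_injective_nat X
  rw [hI.norms_kIdeal.2]
  exact dNum_le_of_tukey (S := EvLE) (fun x n => e (x n))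
    (fun g => ⟨fun n => {a | e a ≤ g n}, fun n => hI.finite _ (finite_preimage_Iic he _)⟩)
    (fun _ _ h => h) exists_evLE

end IsProperIdeal

/-! ## The ideal `Fin ⊗ Fin` -/

theorem mem_finFin {A : Set (ℕ × ℕ)} :
    A ∈ finFin ↔ ∃ (a : ℕ) (h : ℕ → ℕ), ∀ m n, (m, n) ∈ A → m < a ∨ n ≤ h m := by
  simp only [finFin, fubiniProduct, finIdeal, Set.mem_ofPred_eq]
  constructor
  · intro hA
    obtain ⟨a, ha⟩ := hA.bddAbove
    have : ∀ m, ∃ k, a < m → ∀ n, (m, n) ∈ A → n ≤ k := by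
      intro m
      by_cases hm : {y : ℕ | (m, y) ∈ A}.Finite
      · obtain ⟨k, hk⟩ := hm.bddAbove
        exact ⟨k, fun _ n hn => hk hn⟩
      · exact ⟨0, fun h => absurd (ha hm) (by omega)⟩
    choose h hh using this
    refine ⟨a + 1, h, fun m n hmn => ?_⟩
    by_cases hm : a < m
    · exact Or.inr (hh m hm n hmn)
    · exact Or.inl (by omega)
  · rintro ⟨a, h, H⟩
    refine (Set.finite_Iio a).subset fun m hm => ?_
    by_contra hma
    refine hm ((Set.finite_Iic (h m)).subset fun n hn => ?_)
    exact (H m n hn).resolve_left hma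

theorem isProperIdeal_finFin : IsProperIdeal finFin where
  subset A hA B hB := by
    rw [mem_finFin] at *
    obtain ⟨a, h, H⟩ := hA
    exact ⟨a, h, fun m n hmn => H m n (hB hmn)⟩
  union A hA B hB := by
    rw [mem_finFin] at *
    obtain ⟨a, h, H⟩ := hA
    obtain ⟨a', h', H'⟩ := hB
    refine ⟨max a a', fun m => max (h m) (h' m), fun m n hmn => ?_⟩
    rcases hmn with hmn | hmn
    · have := H m n hmn
      simp only [lt_max_iff, le_max_iff]; tauto
    · have := H' m n hmn
      simp only [lt_max_iff, le_max_iff]; tauto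
  finite A hA := by
    rw [mem_finFin]
    obtain ⟨a, ha⟩ := (hA.image Prod.fst).bddAbove
    exact ⟨a + 1, 0, fun m n hmn => Or.inl (Nat.lt_succ_of_le (ha ⟨_, hmn, rfl⟩))⟩
  univ := by
    rw [mem_finFin]
    rintro ⟨a, h, H⟩
    have := H a (h a + 1) trivial
    omega

theorem le_or_le_mem_finFin (a : ℕ) (h : ℕ → ℕ) : {p : ℕ × ℕ | p.1 ≤ a ∨ p.2 ≤ h p.1} ∈ finFin :=
  mem_finFin.2 ⟨a + 1, h, fun _ _ hmn => hmn.imp Nat.lt_succ_of_le id⟩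

/-! ### Constant bounding prediction -/

/-- The sequence of numbers obtained by flattening a sequence of pairs. -/
def interleave (x : ℕ → ℕ × ℕ) (j : ℕ) : ℕ :=
  if j % 2 = 0 then (x (j / 2)).1 else (x (j / 2)).2

theorem interleave_even (x : ℕ → ℕ × ℕ) (n : ℕ) : interleave x (2 * n) = (x n).1 := by
  simp [interleave]

theorem interleave_odd (x : ℕ → ℕ × ℕ) (n : ℕ) : interleave x (2 * n + 1) = (x n).2 := by
  have : (2 * n + 1) / 2 = n := by omega
  simp [interleave, Nat.add_mod, this]

theorem initSeg_interleave (x : ℕ → ℕ × ℕ) (n : ℕ) :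
    initSeg (interleave x) (2 * n) = (initSeg x n).flatMap fun p => [p.1, p.2] := by
  induction n with
  | zero => simp
  | succ n ih =>
    rw [show 2 * (n + 1) = 2 * n + 1 + 1 by ring, initSeg_succ, initSeg_succ, initSeg_succ, ih,
      interleave_even, interleave_odd]
    simp

/-- The sequence of consecutive disjoint pairs of entries. -/
def pairUp (f : ℕ → ℕ) (i : ℕ) : ℕ × ℕ := (f (2 * i), f (2 * i + 1))

/-- The list of the first `k` consecutive disjoint pairs of entries of a list. -/
def pairUpList (s : List ℕ) (k : ℕ) : List (ℕ × ℕ) :=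
  initSeg (pairUp fun j => s.getD j 0) k

theorem pairUpList_initSeg (f : ℕ → ℕ) {j k : ℕ} (h : 2 * k ≤ j) :
    pairUpList (initSeg f j) k = initSeg (pairUp f) k := by
  refine initSeg_congr fun i hi => ?_
  simp only [pairUp]
  rw [getD_initSeg (by omega), getD_initSeg (by omega)]

/-- A Miller null set for `Fin ⊗ Fin` yields a predictor for consecutive disjoint pairs. -/
theorem exists_predictor (φ : List (ℕ × ℕ) → Set (ℕ × ℕ)) (hφ : ∀ s, φ s ∈ finFin) :
    ∃ π : List ℕ → ℕ, ∀ f, pairUp f ∈ millerSet φ →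
      ∀ᶠ n in atTop, ∃ j, 2 * n ≤ j ∧ j < 2 * n + 2 ∧ f j ≤ π (initSeg f j) := by
  choose a h H using fun s => mem_finFin.1 (hφ s)
  refine ⟨fun s => max (a (pairUpList s (s.length / 2)))
    (h (pairUpList s (s.length / 2)) (s.getD (s.length - 1) 0)), fun f hf => ?_⟩
  filter_upwards [hf] with n hn
  rcases H _ _ _ hn with h1 | h2
  · refine ⟨2 * n, le_rfl, by omega, ?_⟩
    rw [length_initSeg, show 2 * n / 2 = n by omega, pairUpList_initSeg f le_rfl]
    exact le_max_of_le_left h1.le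
  · refine ⟨2 * n + 1, by omega, by omega, ?_⟩
    rw [length_initSeg, show (2 * n + 1) / 2 = n by omega, pairUpList_initSeg f (by omega),
      getD_initSeg (by omega)]
    exact le_max_of_le_right h2

/-- Windows starting at an even place are pairs of `f`; those starting at an odd place are pairs of
the shifted sequence. Hence two Miller sets are needed, and the second predictor reads the history
without its first entry. -/
theorem boundingPredicts_of_pairUp {φ φ' : List (ℕ × ℕ) → Set (ℕ × ℕ)} (hφ : ∀ s, φ s ∈ finFin)
    (hφ' : ∀ s, φ' s ∈ finFin) : ∃ π : List ℕ → ℕ, ∀ f, pairUp f ∈ millerSet φ →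
      pairUp (fun i => f (i + 1)) ∈ millerSet φ' → BoundingPredicts 2 f π := by
  obtain ⟨π, hπ⟩ := exists_predictor φ hφ
  obtain ⟨π', hπ'⟩ := exists_predictor φ' hφ'
  refine ⟨fun s => max (π s) (π' s.tail), fun f hf hf' => ?_⟩
  obtain ⟨N, hN⟩ := eventually_atTop.1 (hπ f hf)
  obtain ⟨N', hN'⟩ := eventually_atTop.1 (hπ' _ hf')
  refine eventually_atTop.2 ⟨2 * N + 2 * N' + 1, fun i hi => ?_⟩
  rcases Nat.even_or_odd' i with ⟨n, rfl | rfl⟩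
  · obtain ⟨j, h1, h2, h3⟩ := hN n (by omega)
    exact ⟨j, h1, h2, le_max_of_le_left h3⟩
  · obtain ⟨j, h1, h2, h3⟩ := hN' n (by omega)
    refine ⟨j + 1, by omega, by omega, le_max_of_le_right ?_⟩
    rwa [initSeg_succ', List.tail_cons]

/-- In the window starting at `2 * n`, a correct bound at the first place puts the pair into
finitely many columns, and one at the second place puts it under a graph over the first entry. -/
theorem millerSet_of_boundingPredicts (π : List ℕ → ℕ) :
    ∃ φ : {φ : List (ℕ × ℕ) → Set (ℕ × ℕ) // ∀ s, φ s ∈ finFin},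
      ∀ x, BoundingPredicts 2 (interleave x) π → x ∈ millerSet φ.1 := by
  let fl : List (ℕ × ℕ) → List ℕ := fun s => s.flatMap fun p => [p.1, p.2]
  refine ⟨⟨fun s => {p | p.1 ≤ π (fl s) ∨ p.2 ≤ π (fl s ++ [p.1])},
    fun s => le_or_le_mem_finFin _ fun m => π (fl s ++ [m])⟩, fun x hx => ?_⟩
  have h2 : Tendsto (fun n : ℕ => 2 * n) atTop atTop :=
    tendsto_id.const_mul_atTop' (by norm_num)
  filter_upwards [h2.eventually hx] with n ⟨j, h1, h2, h3⟩
  obtain rfl | rfl : j = 2 * n ∨ j = 2 * n + 1 := by omega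
  · rw [interleave_even, initSeg_interleave] at h3
    exact Or.inl h3
  · rw [interleave_odd, initSeg_succ, interleave_even, initSeg_interleave] at h3
    exact Or.inr h3

theorem exists_boundingPredicts (f : ℕ → ℕ) : ∃ π, BoundingPredicts 2 f π :=
  ⟨fun s => f s.length, Eventually.of_forall fun i => ⟨i, le_rfl, by omega, by simp⟩⟩

theorem exists_not_boundingPredicts (π : List ℕ → ℕ) : ∃ f, ¬ BoundingPredicts 2 f π := by
  obtain ⟨f, hf⟩ := exists_forall_initSeg_notMem (φ := fun s => Set.Iic (π s)) fun s h =>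
    absurd (h ▸ Set.mem_univ (π s + 1) : π s + 1 ∈ Set.Iic (π s)) (by simp)
  refine ⟨f, fun h => ?_⟩
  obtain ⟨i, j, -, -, hj⟩ := h.exists
  exact hf j hj

theorem nonNumber_millerNull_finFin : nonNumber (millerNull finFin) = constBoundingEvasion 2 := by
  have hI := isProperIdeal_finFin
  rw [hI.norms_millerNull.1]
  choose Φ hΦ using millerSet_of_boundingPredicts
  refine le_antisymm ?_ (bNum_le_of_tukey (S := BoundingPredicts 2) interleave Φ
    (fun x π => hΦ π x) fun φ => hI.exists_notMem_millerSet φ.1 φ.2)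
  obtain ⟨F, hF, hc⟩ := exists_mk_eq_bNum (R := BoundingPredicts 2) exists_not_boundingPredicts
  change _ ≤ bNum (BoundingPredicts 2)
  rw [← hc]
  by_contra! hlt
  obtain ⟨φ, hφ⟩ := exists_of_mk_lt_bNum ((Cardinal.mk_image_le (f := pairUp)).trans_lt hlt)
  obtain ⟨φ', hφ'⟩ := exists_of_mk_lt_bNum
    ((Cardinal.mk_image_le (f := fun f : ℕ → ℕ => pairUp fun i => f (i + 1))).trans_lt hlt)
  obtain ⟨π, hπ⟩ := boundingPredicts_of_pairUp φ.2 φ'.2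
  obtain ⟨f, hf, hn⟩ := hF π
  exact hn (hπ f (hφ _ ⟨f, hf, rfl⟩) (hφ' _ ⟨f, hf, rfl⟩))

theorem covNumber_millerNull_finFin :
    covNumber (millerNull finFin) = constBoundingPrediction 2 := by
  have hI := isProperIdeal_finFin
  have hinf := hI.norms_millerNull.2.2
  rw [hI.norms_millerNull.2.1] at hinf ⊢
  choose Φ hΦ using millerSet_of_boundingPredicts
  refine le_antisymm (dNum_le_of_tukey (S := BoundingPredicts 2) interleave Φ
    (fun x π => hΦ π x) exists_boundingPredicts) ?_
  obtain ⟨D, hD, hc⟩ := exists_mk_eq_dNum hI.exists_mem_millerSet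
  rw [← hc] at hinf ⊢
  -- One predictor per pair of Miller sets; since `D` is infinite this does not increase the
  -- cardinality.
  choose P hP using fun p : D × D => boundingPredicts_of_pairUp p.1.1.2 p.2.1.2
  refine (dNum_le_mk (R := BoundingPredicts 2) (D := Set.range P) fun f => ?_).trans
    (Cardinal.mk_range_le.trans ?_)
  · obtain ⟨φ, hφ, h1⟩ := hD (pairUp f)
    obtain ⟨φ', hφ', h2⟩ := hD (pairUp fun i => f (i + 1))
    exact ⟨_, ⟨(⟨φ, hφ⟩, ⟨φ', hφ'⟩), rfl⟩, hP (⟨φ, hφ⟩, ⟨φ', hφ'⟩) f h1 h2⟩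
  · rw [← Cardinal.mul_def, Cardinal.mul_eq_self hinf]

/-! ### The non-adaptive ideal -/

/-- A monotone function that is bounded by `g` along an infinite set is dominated by a function
depending on `g` and that set only. -/
theorem exists_bound_along {B : Set ℕ} (hB : B.Infinite) (g : ℕ → ℕ) :
    ∃ g' : ℕ → ℕ, ∀ f : ℕ → ℕ, Monotone f → (∀ᶠ n in atTop, n ∈ B → f n ≤ g n) → EvLE f g' := by
  choose b hb hlt using fun n => hB.exists_gt n
  refine ⟨fun n => g (b n), fun f hf h => ?_⟩
  obtain ⟨N, hN⟩ := eventually_atTop.1 h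
  refine eventually_atTop.2 ⟨N, fun n hn => ?_⟩
  exact (hf (hlt n).le).trans (hN _ (hn.trans (hlt n).le) (hb n))

/-- The running maximum of `f`. -/
def runningMax (f : ℕ → ℕ) (n : ℕ) : ℕ := (Finset.range (n + 1)).sup f

theorem monotone_runningMax (f : ℕ → ℕ) : Monotone (runningMax f) := fun _ _ h =>
  Finset.sup_mono (Finset.range_subset_range.2 (by omega))

theorem le_runningMax (f : ℕ → ℕ) (n : ℕ) : f n ≤ runningMax f n :=
  Finset.le_sup (Finset.mem_range.2 (by omega))

/-- For each member of the non-adaptive ideal, two successive bounds control the pairs in it. -/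
theorem kSet_finFin_control (φ : ℕ → Set (ℕ × ℕ)) (hφ : ∀ n, φ n ∈ finFin) :
    ∃ a : ℕ → ℕ, ∀ f, ¬ EvLE f a → ∃ g : ℕ → ℕ, ∀ f', Monotone f' →
      (fun n => (f n, f' n)) ∈ kSet φ → EvLE f' g := by
  choose a h H using fun s => mem_finFin.1 (hφ s)
  refine ⟨a, fun f hf => ?_⟩
  have hB : {n | a n < f n}.Infinite := Nat.frequently_atTop_iff_infinite.1
    (by rw [EvLE, not_eventually] at hf; simpa only [not_le] using hf)
  obtain ⟨g, hg⟩ := exists_bound_along hB fun n => h n (f n)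
  refine ⟨g, fun f' hf' hk => hg f' hf' ?_⟩
  filter_upwards [hk] with n hn (hnB : a n < f n)
  exact (H n _ _ hn).resolve_left (by omega)

/-- The second bound depends on the first function, so pairs from an unbounded family are used:
first `f` escapes the column bounds, then `f'` escapes the resulting bound. The running maximum
supplies the monotonicity needed to pass from an infinite set to all arguments. -/
theorem nonNumber_kIdeal_finFin : nonNumber (kIdeal finFin) = boundingNumber := by
  have hI := isProperIdeal_finFin
  refine le_antisymm ?_ hI.boundingNumber_le
  obtain ⟨F, hF, hc⟩ := exists_mk_eq_bNum exists_not_evLE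
  rw [hI.norms_kIdeal.1]
  refine (bNum_le_mk (F := Set.range fun p : F × F => fun n => (p.1.1 n, runningMax p.2.1 n))
    fun φ => ?_).trans (Cardinal.mk_range_le.trans ?_)
  · obtain ⟨a, ha⟩ := kSet_finFin_control φ.1 φ.2
    obtain ⟨f, hf, hfa⟩ := hF a
    obtain ⟨g, hg⟩ := ha f hfa
    obtain ⟨f', hf', hfg⟩ := hF g
    refine ⟨_, ⟨(⟨f, hf⟩, ⟨f', hf'⟩), rfl⟩, fun h => hfg ?_⟩
    exact (hg _ (monotone_runningMax f') h).mono fun n hn => (le_runningMax f' n).trans hn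
  · have := aleph0_le_boundingNumber
    rw [← Cardinal.mul_def, hc, ← boundingNumber_eq,
      Cardinal.mul_eq_self this]

theorem covNumber_kIdeal_finFin : covNumber (kIdeal finFin) = dominatingNumber := by
  have hI := isProperIdeal_finFin
  refine le_antisymm hI.covNumber_le_dominatingNumber ?_
  rw [hI.norms_kIdeal.2]
  obtain ⟨D, hD, hc⟩ := exists_mk_eq_dNum hI.exists_mem_kSet
  rw [← hc]
  by_contra! hlt
  choose a ha using fun φ : {φ : ℕ → Set (ℕ × ℕ) // ∀ n, φ n ∈ finFin} =>
    kSet_finFin_control φ.1 φ.2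
  -- Smallness of `D` is used twice: `f` is chosen against all column bounds, then `f'` against the
  -- bounds that arise from `f`.
  obtain ⟨f, hf⟩ := exists_of_mk_lt_dNum (R := EvLE) (Cardinal.mk_image_le (f := a).trans_lt hlt)
  choose! g hg using fun φ (hφ : φ ∈ D) => ha φ f (hf _ ⟨φ, hφ, rfl⟩)
  obtain ⟨f', hf'⟩ := exists_of_mk_lt_dNum (R := EvLE) (Cardinal.mk_image_le (f := g).trans_lt hlt)
  obtain ⟨φ, hφ, h⟩ := hD fun n => (f n, runningMax f' n)
  refine hf' _ ⟨φ, hφ, rfl⟩ ?_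
  exact (hg φ hφ _ (monotone_runningMax f') h).mono fun n hn => (le_runningMax f' n).trans hn

/-! ## The coin-tossing measure -/

instance : IsProbabilityMeasure cantorMeasure := by
  unfold cantorMeasure
  infer_instance

/-- The restriction of a point of the Cantor space to its first `n` coordinates. -/
def restr (n : ℕ) (z : ℕ → Bool) : Fin n → Bool := fun i => z i

theorem restr_eq_restr {n : ℕ} {y z : ℕ → Bool} :
    restr n y = restr n z ↔ ∀ i < n, y i = z i :=
  ⟨fun h i hi => congrFun h ⟨i, hi⟩, fun h => funext fun i => h i i.2⟩

theorem continuous_restr (n : ℕ) : Continuous (restr n) :=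
  continuous_pi fun i => continuous_apply (i : ℕ)

theorem measurable_restr (n : ℕ) : Measurable (restr n) :=
  (continuous_restr n).measurable

theorem uniform_bool_singleton (b : Bool) :
    (PMF.uniformOfFintype Bool).toMeasure {b} = 2⁻¹ := by
  rw [PMF.toMeasure_apply_singleton _ _ (measurableSet_singleton b)]
  simp

theorem cantorMeasure_restr_singleton {n : ℕ} (s : Fin n → Bool) :
    cantorMeasure (restr n ⁻¹' {s}) = 2⁻¹ ^ n := by
  let t : ℕ → Set Bool := fun i => {b | ∀ h : i < n, b = s ⟨i, h⟩}
  have h1 : restr n ⁻¹' {s} = Set.pi (Finset.range n : Set ℕ) t := by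
    ext z
    simp only [restr, Set.mem_preimage, Set.mem_singleton_iff, funext_iff, Set.mem_pi,
      Finset.coe_range, Set.mem_Iio, t, Set.mem_ofPred_eq]
    exact ⟨fun h i hi _ => h ⟨i, hi⟩, fun h i => h i i.2 i.2⟩
  rw [h1, cantorMeasure, Measure.infinitePi_pi _ fun i _ => MeasurableSet.of_discrete]
  rw [Finset.prod_congr rfl fun i hi => ?_, Finset.prod_const, Finset.card_range]
  have : t i = {s ⟨i, Finset.mem_range.1 hi⟩} := by
    ext b
    simp only [t, Set.mem_ofPred_eq, Set.mem_singleton_iff]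
    exact ⟨fun h => h _, fun h _ => h⟩
  rw [this, uniform_bool_singleton]

theorem cantorMeasure_restr {n : ℕ} (S : Finset (Fin n → Bool)) :
    cantorMeasure (restr n ⁻¹' S) = S.card * 2⁻¹ ^ n := by
  have : restr n ⁻¹' (S : Set (Fin n → Bool)) = ⋃ s ∈ S, restr n ⁻¹' {s} := by
    ext z; simp
  rw [this, measure_biUnion_finset (fun s _ t _ hst => Disjoint.preimage _ (by simpa using hst))
    fun s _ => measurable_restr n (measurableSet_singleton s)]
  simp [cantorMeasure_restr_singleton]

theorem exists_cylinder_subset {O : Set (ℕ → Bool)} (hO : IsOpen O) {y : ℕ → Bool} (hy : y ∈ O) :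
    ∃ k, ∀ z, (∀ i < k, z i = y i) → z ∈ O := by
  obtain ⟨I, u, hu, hsub⟩ := isOpen_pi_iff.1 hO y hy
  refine ⟨I.sup id + 1, fun z hz => hsub fun i hi => ?_⟩
  rw [hz i (Nat.lt_succ_of_le (Finset.le_sup (f := id) hi))]
  exact (hu i hi).2

theorem inv_two_pow_mul_two_pow (k : ℕ) : (2⁻¹ : ENNReal) ^ k * 2 ^ k = 1 := by
  rw [← mul_pow, ENNReal.inv_mul_cancel (by norm_num) (by norm_num), one_pow]

/-! ### Clopen sets of measure one half -/

/-- `S` contains at most half of the nodes at level `k + 1`; enlarge it to exactly half and take the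
complement. -/
theorem exists_halfClopen {k : ℕ} (S : Finset (Fin (k + 1) → Bool)) (hS : S.card ≤ 2 ^ k) :
    ∃ U : HalfClopen, ∀ z, restr (k + 1) z ∈ S → z ∉ U.1 := by
  classical
  obtain ⟨T, hST, -, hT⟩ := Finset.exists_subsuperset_card_eq (Finset.subset_univ S) hS
    (by simp [pow_succ])
  have hcl : IsClopen (restr (k + 1) ⁻¹' (Tᶜ : Finset _)) :=
    (isClopen_discrete _).preimage (continuous_restr _)
  refine ⟨⟨⟨_, hcl⟩, ?_⟩, fun z hz h => ?_⟩
  · change cantorMeasure (restr (k + 1) ⁻¹' (Tᶜ : Finset _)) = 1 / 2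
    rw [cantorMeasure_restr, Finset.card_compl, hT]
    simp only [Fintype.card_pi, Fintype.card_bool, Finset.prod_const, Finset.card_univ,
      Fintype.card_fin]
    rw [pow_succ, mul_two, Nat.add_sub_cancel, pow_succ, ← mul_assoc, mul_comm _ (2⁻¹ ^ k)]
    push_cast
    rw [inv_two_pow_mul_two_pow, one_mul, one_div]
  · have : restr (k + 1) z ∈ Tᶜ := h
    exact Finset.mem_compl.1 this (hST hz)

/-- Every null set is avoided pointwise eventually by a sequence of clopen sets of measure `1/2`. -/
theorem exists_seq_halfClopen {N : Set (ℕ → Bool)} (hN : cantorMeasure N = 0) :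
    ∃ U : ℕ → HalfClopen, ∀ y ∈ N, ∀ᶠ k in atTop, y ∉ (U k).1 := by
  classical
  obtain ⟨O, hNO, hO, hlt⟩ := N.exists_isOpen_lt_of_lt (μ := cantorMeasure) (2⁻¹ : ENNReal)
    (by rw [hN]; norm_num)
  -- The nodes whose cylinders lie inside `O`. They make up less than half of each level, and every
  -- point of `O` eventually passes through them.
  let S : ∀ k, Finset (Fin k → Bool) := fun k =>
    Finset.univ.filter fun s => ∀ z, restr k z = s → z ∈ O
  have hS : ∀ k, (S (k + 1)).card ≤ 2 ^ k := by
    intro k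
    have h1 : cantorMeasure (restr (k + 1) ⁻¹' S (k + 1)) ≤ 2⁻¹ :=
      (measure_mono fun z hz => by
        have : restr (k + 1) z ∈ S (k + 1) := hz
        exact (Finset.mem_filter.1 this).2 z rfl).trans hlt.le
    rw [cantorMeasure_restr] at h1
    have h2 := mul_le_mul_left h1 (2 ^ (k + 1))
    rw [mul_assoc, inv_two_pow_mul_two_pow, mul_one, pow_succ, mul_comm (2⁻¹ : ENNReal), mul_assoc,
      ENNReal.mul_inv_cancel (by norm_num) (by norm_num), mul_one] at h2
    exact_mod_cast h2
  choose U hU using fun k => exists_halfClopen (S (k + 1)) (hS k)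
  refine ⟨U, fun y hy => ?_⟩
  obtain ⟨k, hk⟩ := exists_cylinder_subset hO (hNO hy)
  filter_upwards [eventually_ge_atTop k] with j hj
  refine hU j y (Finset.mem_filter.2 ⟨Finset.mem_univ _, fun z hz => hk z fun i hi => ?_⟩)
  exact restr_eq_restr.1 hz i (by omega)

/-- The proportion of nodes of length `n` in the tree of a closed null set tends to zero. -/
theorem tendsto_cantorMeasure_tree {C : Set (ℕ → Bool)} (hC : IsClosed C)
    (h0 : cantorMeasure C = 0) :
    Tendsto (fun n => cantorMeasure (restr n ⁻¹' (restr n '' C))) atTop (𝓝 0) := by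
  have hC' : C = ⋂ n, restr n ⁻¹' (restr n '' C) := by
    refine Set.Subset.antisymm (Set.subset_iInter fun n => Set.subset_preimage_image _ _) ?_
    intro y hy
    by_contra hyC
    obtain ⟨k, hk⟩ := exists_cylinder_subset hC.isOpen_compl hyC
    obtain ⟨z, hz, hzy⟩ := Set.mem_iInter.1 hy k
    exact hk z (restr_eq_restr.1 hzy) hz
  have := tendsto_measure_iInter_atTop (μ := cantorMeasure)
    (s := fun n => restr n ⁻¹' (restr n '' C))
    (fun n => (measurable_restr n (Set.toFinite _).measurableSet).nullMeasurableSet)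
    (fun m n hmn y ⟨z, hz, hzy⟩ => ⟨z, hz, restr_eq_restr.2 fun i hi =>
      restr_eq_restr.1 hzy i (hi.trans_le hmn)⟩) ⟨0, measure_ne_top _ _⟩
  rwa [← hC', h0] at this

/-! ## Transfer of null sets between the reals and other spaces -/

/-- Any Borel probability measure on a standard Borel space is an image of Lebesgue measure on [0,
1]. Extending the map periodically makes a preimage in ℝ a subset of countably many translates of
one null set. -/
theorem exists_nullTransfer_from_real {Y : Type} [MeasurableSpace Y] [StandardBorelSpace Y]
    (μ : Measure Y) [IsProbabilityMeasure μ] :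
    ∃ g : ℝ → Y, ∀ N, μ N = 0 → volume (g ⁻¹' N) = 0 := by
  have : Nonempty Y := nonempty_of_isProbabilityMeasure μ
  obtain ⟨f, hf, hmap⟩ := μ.exists_measurable_map_eq
  refine ⟨fun r => f ⟨Int.fract r, Int.fract_nonneg r, (Int.fract_lt_one r).le⟩, fun N hN => ?_⟩
  have h1 : volume (f ⁻¹' N) = 0 := by
    rw [← hmap] at hN
    exact Measure.preimage_null_of_map_null hf.aemeasurable hN
  have h2 : volume (((↑) : unitInterval → ℝ) '' (f ⁻¹' N)) = 0 := by
    change Measure.comap Subtype.val volume (f ⁻¹' N) = 0 at h1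
    rwa [comap_subtype_coe_apply measurableSet_Icc] at h1
  have h3 : (fun r : ℝ => f ⟨Int.fract r, Int.fract_nonneg r, (Int.fract_lt_one r).le⟩) ⁻¹' N ⊆
      ⋃ z : ℤ, (fun r : ℝ => r + -z) ⁻¹' (((↑) : unitInterval → ℝ) '' (f ⁻¹' N)) := fun r hr =>
    Set.mem_iUnion.2 ⟨⌊r⌋, _, hr, sub_eq_add_neg _ _⟩
  refine measure_mono_null h3 (measure_iUnion_null fun z => ?_)
  rw [measure_preimage_add_right, h2]

/-- The number with binary digits `z 0, …, z (n - 1)`, most significant first. -/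
def binVal (z : ℕ → Bool) : ℕ → ℕ
  | 0 => 0
  | n + 1 => 2 * binVal z n + (z n).toNat

theorem eq_of_binVal_eq {y z : ℕ → Bool} {n : ℕ} (h : binVal y n = binVal z n) :
    ∀ i < n, y i = z i := by
  induction n with
  | zero => simp
  | succ n ih =>
    simp only [binVal] at h
    have h1 := Bool.toNat_lt (y n)
    have h2 := Bool.toNat_lt (z n)
    have h3 : (y n).toNat = (z n).toNat := by omega
    intro i hi
    rcases Nat.lt_succ_iff_lt_or_eq.1 hi with hi | rfl
    · exact ih (by omega) i hi
    · revert h3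
      cases y i <;> cases z i <;> simp

theorem cantorMeasure_binVal_le (n : ℕ) (K : Finset ℤ) :
    cantorMeasure {z | (binVal z n : ℤ) ∈ K} ≤ K.card * 2⁻¹ ^ n := by
  have h : {z | (binVal z n : ℤ) ∈ K} = ⋃ k ∈ K, {z | (binVal z n : ℤ) = k} := by
    ext z; simp
  rw [h]
  refine (measure_biUnion_finset_le _ _).trans
    ((Finset.sum_le_card_nsmul _ _ (2⁻¹ ^ n) fun k _ => ?_).trans_eq (nsmul_eq_mul _ _))
  rcases Set.eq_empty_or_nonempty {z | (binVal z n : ℤ) = k} with h | ⟨y, hy⟩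
  · simp [h]
  · rw [← cantorMeasure_restr_singleton (restr n y)]
    refine measure_mono fun z (hz : _ = _) => restr_eq_restr.2 (eq_of_binVal_eq ?_)
    exact_mod_cast hz.trans (Eq.symm hy)

/-- The real number in `[0, 1]` with binary expansion `z`. -/
noncomputable def binReal (z : ℕ → Bool) : ℝ := ⨆ n, (binVal z n : ℝ) / 2 ^ n

/-- The dyadic intervals given by the first `n` digits are nested, so the supremum of their left
endpoints lies in all of them. -/
theorem binReal_mem (z : ℕ → Bool) (n : ℕ) :
    (binVal z n : ℝ) ≤ 2 ^ n * binReal z ∧ 2 ^ n * binReal z ≤ binVal z n + 1 := by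
  have hmono : Monotone fun n => (binVal z n : ℝ) / 2 ^ n := by
    refine monotone_nat_of_le_succ fun n => ?_
    rw [div_le_div_iff₀ (by positivity) (by positivity), pow_succ, binVal]
    push_cast
    have : (0 : ℝ) ≤ (z n).toNat * 2 ^ n := by positivity
    nlinarith
  have hanti : Antitone fun n => ((binVal z n : ℝ) + 1) / 2 ^ n := by
    refine antitone_nat_of_succ_le fun n => ?_
    rw [div_le_div_iff₀ (by positivity) (by positivity), pow_succ, binVal]
    push_cast
    have h1 : ((z n).toNat : ℝ) ≤ 1 := by exact_mod_cast Nat.lt_succ_iff.1 (Bool.toNat_lt (z n))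
    have : ((z n).toNat : ℝ) * 2 ^ n ≤ 1 * 2 ^ n := by gcongr
    nlinarith
  have h := Set.mem_iInter.1 (hmono.ciSup_mem_iInter_Icc_of_antitone hanti fun n => by
    dsimp only; gcongr; linarith) n
  rw [Set.mem_Icc, div_le_iff₀' (by positivity), le_div_iff₀' (by positivity)] at h
  exact h

/-- At level `n` at most 2ⁿ(b − a) + 2 dyadic intervals are relevant, each of measure 2⁻ⁿ; the error
2 · 2⁻ⁿ vanishes in the limit. -/
theorem cantorMeasure_binReal_Ioc (a b : ℝ) :
    cantorMeasure (binReal ⁻¹' Set.Ioc a b) ≤ ENNReal.ofReal (b - a) := by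
  rcases lt_or_ge b a with hab | hab
  · simp [Set.Ioc_eq_empty_of_le hab.le]
  have hlim : Tendsto (fun n : ℕ => ENNReal.ofReal (b - a + 2 * 2⁻¹ ^ n)) atTop
      (𝓝 (ENNReal.ofReal (b - a))) := by
    refine ENNReal.tendsto_ofReal ?_
    have := (tendsto_pow_atTop_nhds_zero_of_lt_one (r := (2⁻¹ : ℝ)) (by norm_num)
      (by norm_num)).const_mul 2 |>.const_add (b - a)
    simpa using this
  refine ge_of_tendsto' hlim fun n => ?_
  have hsub : binReal ⁻¹' Set.Ioc a b ⊆
      {z | (binVal z n : ℤ) ∈ Finset.Icc ⌈2 ^ n * a - 1⌉ ⌊2 ^ n * b⌋} := by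
    rintro z ⟨h1, h2⟩
    obtain ⟨h3, h4⟩ := binReal_mem z n
    have h5 : (2 : ℝ) ^ n * a ≤ 2 ^ n * binReal z := by gcongr
    have h6 : (2 : ℝ) ^ n * binReal z ≤ 2 ^ n * b := by gcongr
    simp only [Set.mem_ofPred_eq, Finset.mem_Icc, Int.ceil_le, Int.le_floor]
    push_cast
    constructor <;> linarith
  refine (measure_mono hsub).trans ((cantorMeasure_binVal_le n _).trans ?_)
  have h2 : (2⁻¹ : ENNReal) ^ n = ENNReal.ofReal (2⁻¹ ^ n) := by
    rw [ENNReal.ofReal_pow (by norm_num), ENNReal.ofReal_inv_of_pos (by norm_num)]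
    simp
  rw [h2, ← ENNReal.ofReal_natCast, ← ENNReal.ofReal_mul (by positivity)]
  refine ENNReal.ofReal_le_ofReal ?_
  have hp : (2 : ℝ) ^ n * 2⁻¹ ^ n = 1 := by rw [← mul_pow]; norm_num
  have hcard : ((Finset.Icc ⌈2 ^ n * a - 1⌉ ⌊2 ^ n * b⌋).card : ℝ) ≤ 2 ^ n * (b - a) + 2 := by
    rw [Int.card_Icc]
    have h0 : (0 : ℝ) ≤ 2 ^ n * (b - a) := mul_nonneg (by positivity) (by linarith)
    rcases le_total (⌊(2 : ℝ) ^ n * b⌋ + 1 - ⌈(2 : ℝ) ^ n * a - 1⌉) 0 with h | h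
    · rw [Int.toNat_of_nonpos h]
      push_cast
      linarith
    · have : (((⌊(2 : ℝ) ^ n * b⌋ + 1 - ⌈(2 : ℝ) ^ n * a - 1⌉).toNat : ℤ) : ℝ) =
          (⌊(2 : ℝ) ^ n * b⌋ : ℝ) + 1 - ⌈(2 : ℝ) ^ n * a - 1⌉ := by
        rw [Int.toNat_of_nonneg h]; push_cast; ring
      rw [Int.cast_natCast] at this
      rw [this]
      have := Int.floor_le ((2 : ℝ) ^ n * b)
      have := Int.le_ceil ((2 : ℝ) ^ n * a - 1)
      linarith
  calc _ ≤ (2 ^ n * (b - a) + 2) * (2⁻¹ : ℝ) ^ n := by gcongr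
    _ = (2 ^ n * 2⁻¹ ^ n) * (b - a) + 2 * 2⁻¹ ^ n := by ring
    _ = _ := by rw [hp, one_mul]

/-- Lebesgue outer measure is the largest outer measure bounded by the length of intervals, so it
dominates the image of the coin-tossing measure. No measurability of `N` is needed. -/
theorem cantorMeasure_preimage_binReal {N : Set ℝ} (hN : volume N = 0) :
    cantorMeasure (binReal ⁻¹' N) = 0 := by
  have h : OuterMeasure.map binReal cantorMeasure.toOuterMeasure ≤
      (StieltjesFunction.id : StieltjesFunction ℝ).outer := by
    unfold StieltjesFunction.outer
    refine OuterMeasure.le_ofFunction.2 fun s => ?_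
    rw [StieltjesFunction.length_eq]
    refine le_iInf fun a => le_iInf fun b => le_iInf fun hs => ?_
    have hbot : (botSet : Set ℝ) = ∅ :=
      Set.eq_empty_of_forall_notMem fun x (hx : IsBot x) => not_isBot x hx
    rw [hbot, Set.sdiff_empty] at hs
    exact (measure_mono (Set.preimage_mono hs)).trans (cantorMeasure_binReal_Ioc a b)
  rw [Real.volume_eq_stieltjes_id, StieltjesFunction.measure] at hN
  exact nonpos_iff_eq_zero.1 ((h N).trans_eq hN)

/-! ## The Solecki ideal -/

theorem cantorMeasure_countable {A : Set (ℕ → Bool)} (hA : A.Countable) : cantorMeasure A = 0 := by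
  rw [← Set.biUnion_of_singleton A]
  refine (measure_biUnion_null_iff hA).2 fun y _ => ?_
  have hlim : Tendsto (fun n : ℕ => (2⁻¹ : ENNReal) ^ n) atTop (𝓝 0) :=
    ENNReal.tendsto_pow_atTop_nhds_zero_of_lt_one (by norm_num)
  refine nonpos_iff_eq_zero.1 (ge_of_tendsto' hlim fun n => ?_)
  rw [← cantorMeasure_restr_singleton (restr n y)]
  exact measure_mono fun z hz => congrArg _ hz

theorem mem_solecki {A : Set HalfClopen} :
    A ∈ solecki ↔ ∃ P : Set (ℕ → Bool), P.Finite ∧ ∀ U ∈ A, ∃ y ∈ P, y ∈ U.1 := by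
  constructor
  · rintro ⟨F, hF, hfin, hA⟩
    have hF' : ∀ B ∈ F, ∃ y : ℕ → Bool, ∀ U ∈ B, y ∈ U.1 := fun B hB => hF hB
    choose! y hy using hF'
    refine ⟨y '' F, hfin.image y, fun U hU => ?_⟩
    obtain ⟨B, hB, hUB⟩ := hA hU
    exact ⟨y B, ⟨B, hB, rfl⟩, hy B hB U hUB⟩
  · rintro ⟨P, hP, hA⟩
    refine ⟨(fun y => {U : HalfClopen | y ∈ U.1}) '' P, ?_, hP.image _, fun U hU => ?_⟩
    · rintro _ ⟨y, -, rfl⟩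
      exact ⟨y, fun U hU => hU⟩
    · obtain ⟨y, hy, hyU⟩ := hA U hU
      exact ⟨_, ⟨y, hy, rfl⟩, hyU⟩

theorem HalfClopen.nonempty (U : HalfClopen) : ∃ y, y ∈ U.1 := by
  by_contra! h
  have h0 : (U.1 : Set (ℕ → Bool)) = ∅ := Set.eq_empty_of_forall_notMem h
  have := U.2
  rw [h0, measure_empty, one_div] at this
  exact ENNReal.inv_ne_zero.2 ENNReal.ofNat_ne_top this.symm

instance : Countable HalfClopen := by
  have : Countable (TopologicalSpace.Clopens (ℕ → Bool)) :=
    TopologicalSpace.Clopens.countable_iff_secondCountable.2 inferInstance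
  unfold HalfClopen
  infer_instance

theorem isProperIdeal_solecki : IsProperIdeal solecki where
  subset A hA B hB := by
    rw [mem_solecki] at *
    obtain ⟨P, hP, h⟩ := hA
    exact ⟨P, hP, fun U hU => h U (hB hU)⟩
  union A hA B hB := by
    rw [mem_solecki] at *
    obtain ⟨P, hP, h⟩ := hA
    obtain ⟨P', hP', h'⟩ := hB
    refine ⟨P ∪ P', hP.union hP', ?_⟩
    rintro U (hU | hU)
    · obtain ⟨y, hy, hyU⟩ := h U hU
      exact ⟨y, Or.inl hy, hyU⟩
    · obtain ⟨y, hy, hyU⟩ := h' U hU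
      exact ⟨y, Or.inr hy, hyU⟩
  finite A hA := by
    choose y hy using HalfClopen.nonempty
    exact mem_solecki.2 ⟨y '' A, hA.image y, fun U hU => ⟨y U, ⟨U, hU, rfl⟩, hy U⟩⟩
  univ := by
    rw [mem_solecki]
    rintro ⟨P, hP, h⟩
    -- The finite set `P` is null, so some clopen set of measure 1/2 avoids it.
    obtain ⟨U, hU⟩ := exists_seq_halfClopen (cantorMeasure_countable hP.countable)
    obtain ⟨k, hk⟩ := (hP.eventually_all.2 hU).exists
    obtain ⟨y, hy, hyU⟩ := h (U k) trivial
    exact hk y hy hyU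

/-- A sequence of clopen sets eventually avoiding each point that a Miller null set uses can be
reindexed by any function escaping a suitable predictor so as to leave the Miller null set. -/
theorem exists_predictor_of_avoiding {φ : List HalfClopen → Set HalfClopen}
    {P : List HalfClopen → Set (ℕ → Bool)} (hP : ∀ s, (P s).Finite)
    (hφ : ∀ s, ∀ V ∈ φ s, ∃ y ∈ P s, y ∈ V.1) {U : ℕ → HalfClopen}
    (hU : ∀ s, ∀ y ∈ P s, ∀ᶠ k in atTop, y ∉ (U k).1) :
    ∃ π : List ℕ → ℕ, ∀ f : ℕ → ℕ, (∃ᶠ n in atTop, π (initSeg f n) < f n) →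
      (fun n => U (f n)) ∉ millerSet φ := by
  have h : ∀ s, ∃ N, ∀ k, N ≤ k → ∀ y ∈ P s, y ∉ (U k).1 := fun s =>
    eventually_atTop.1 ((hP s).eventually_all.2 (hU s))
  choose N hN using h
  -- The predictor sees the indices chosen so far, which determine the node of the resulting
  -- sequence.
  refine ⟨fun t => N (t.map U), fun f hf hx => ?_⟩
  obtain ⟨n, hn, hxn⟩ := (hf.and_eventually hx).exists
  obtain ⟨y, hy, hyU⟩ := hφ _ _ hxn
  rw [← map_initSeg U f] at hy
  exact hN _ _ hn.le y hy hyU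

theorem exists_covOmega_family : ∃ 𝒜 : Set (Set ℝ), 𝒜 ⊆ nullIdeal ∧
    (∀ B : Set ℝ, B.Countable → ∃ A ∈ 𝒜, B ⊆ A) ∧ Cardinal.mk 𝒜 = covOmegaNull :=
  csInf_mem (s := {κ | ∃ 𝒜 : Set (Set ℝ), 𝒜 ⊆ nullIdeal ∧
    (∀ B : Set ℝ, B.Countable → ∃ A ∈ 𝒜, B ⊆ A) ∧ Cardinal.mk 𝒜 = κ})
    ⟨_, nullIdeal, subset_rfl, fun B hB => ⟨B, hB.measure_zero _, subset_rfl⟩, rfl⟩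

/-- The points used by `φ` at all nodes together form a countable set, so one null set of the family
contains their images. This is why cov_ω appears in place of cov. -/
theorem nonNumber_millerNull_solecki_le :
    nonNumber (millerNull solecki) ≤ max boundingNumber covOmegaNull := by
  have hI := isProperIdeal_solecki
  obtain ⟨F, hFc, hF⟩ := exists_escaping_family
  obtain ⟨𝒜, h𝒜, hcov, h𝒜c⟩ := exists_covOmega_family
  choose U hU using fun A : 𝒜 => exists_seq_halfClopen (cantorMeasure_preimage_binReal (h𝒜 A.2))
  rw [hI.norms_millerNull.1]
  refine (bNum_le_mk (F := Set.range fun p : F × 𝒜 => fun n => U p.2 (p.1.1 n))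
    fun φ => ?_).trans (Cardinal.mk_range_le.trans ?_)
  · choose P hP hφ using fun s => mem_solecki.1 (φ.2 s)
    obtain ⟨A, hA, hsub⟩ := hcov (binReal '' ⋃ s, P s)
      ((Set.countable_iUnion fun s => (hP s).countable).image _)
    obtain ⟨π, hπ⟩ := exists_predictor_of_avoiding hP hφ (U := U ⟨A, hA⟩) fun s y hy =>
      hU ⟨A, hA⟩ y (hsub ⟨y, Set.mem_iUnion.2 ⟨s, hy⟩, rfl⟩)
    obtain ⟨f, hf, hesc⟩ := hF π
    exact ⟨_, ⟨(⟨f, hf⟩, ⟨A, hA⟩), rfl⟩, hπ f hesc⟩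
  · rw [← Cardinal.mul_def, hFc, h𝒜c]
    exact Cardinal.mul_le_max_of_aleph0_le_left aleph0_le_boundingNumber

/-- Fewer than non(𝓝) Miller sets use fewer than non(𝓝) points altogether, so one null set handles
all of them, and one `f` escapes all the predictors. -/
theorem le_covNumber_millerNull_solecki :
    min dominatingNumber (nonNumber nullIdeal) ≤ covNumber (millerNull solecki) := by
  have hI := isProperIdeal_solecki
  have hinf := hI.norms_millerNull.2.2
  rw [hI.norms_millerNull.2.1] at hinf ⊢
  obtain ⟨D, hD, hc⟩ := exists_mk_eq_dNum hI.exists_mem_millerSet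
  rw [← hc] at hinf ⊢
  by_contra! hlt
  obtain ⟨hd, hn⟩ := lt_min_iff.1 hlt
  choose P hP hφ using fun (φ : D) s => mem_solecki.1 (φ.1.2 s)
  have hB : Cardinal.mk (⋃ φ : D, ⋃ s, P φ s : Set (ℕ → Bool)) ≤ Cardinal.mk D := by
    refine (Cardinal.mk_iUnion_le _).trans ((mul_le_mul_right (ciSup_le' fun φ =>
      (Set.countable_iUnion fun s => (hP φ s).countable).le_aleph0) _).trans ?_)
    rw [Cardinal.mul_aleph0_eq hinf]
  have hnull : volume (binReal '' ⋃ φ : D, ⋃ s, P φ s) = 0 := by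
    by_contra h
    exact (csInf_le' ⟨_, h, rfl⟩ : nonNumber nullIdeal ≤ _).not_gt
      ((Cardinal.mk_image_le.trans hB).trans_lt hn)
  obtain ⟨U, hU⟩ := exists_seq_halfClopen (cantorMeasure_preimage_binReal hnull)
  choose π hπ using fun φ : D => exists_predictor_of_avoiding (hP φ) (hφ φ) (U := U) fun s y hy =>
    hU y ⟨y, Set.mem_iUnion.2 ⟨φ, Set.mem_iUnion.2 ⟨s, hy⟩⟩, rfl⟩
  obtain ⟨f, hf⟩ := exists_escaping_of_mk_lt π hd
  obtain ⟨φ, hφD, hx⟩ := hD fun n => U (f n)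
  exact hπ ⟨φ, hφD⟩ f (hf _) hx

/-! ### Random finite sets of points -/

/-- The product of countably many copies of the coin-tossing measure. -/
noncomputable def cantorSeqMeasure : Measure (ℕ → ℕ → Bool) :=
  Measure.infinitePi fun _ : ℕ => cantorMeasure

instance : IsProbabilityMeasure cantorSeqMeasure := by
  unfold cantorSeqMeasure
  infer_instance

theorem cantorSeqMeasure_avoid (V : HalfClopen) (n : ℕ) :
    cantorSeqMeasure {y | ∀ i < n, y i ∉ V.1} = 2⁻¹ ^ n := by
  have h : {y : ℕ → ℕ → Bool | ∀ i < n, y i ∉ V.1} =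
      Set.pi (Finset.range n : Set ℕ) fun _ => (V.1 : Set (ℕ → Bool))ᶜ := by
    ext y; simp [Set.mem_pi]
  have hV : MeasurableSet (V.1 : Set (ℕ → Bool)) := V.1.isClopen.isOpen.measurableSet
  rw [h, cantorSeqMeasure, Measure.infinitePi_pi _ fun _ _ => hV.compl, Finset.prod_const,
    Finset.card_range, prob_compl_eq_one_sub hV, V.2, one_div, ENNReal.one_sub_inv_two]

theorem cantorSeqMeasure_frequently_avoid (x : ℕ → HalfClopen) :
    cantorSeqMeasure {y | ∃ᶠ n in atTop, ∀ i < n, y i ∉ (x n).1} = 0 := by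
  refine measure_setOfPred_frequently_eq_zero ?_
  simp only [cantorSeqMeasure_avoid]
  rw [ENNReal.tsum_geometric]
  simp

/-- To each `x` belongs the null set of random sequences whose first `n` points miss `x n`
infinitely often. For a countable set of reals, `φ n` collects the first `n` points of the first `n`
associated sequences; if `x` leaves this K-set, its null set contains every one of the reals. -/
theorem covOmegaNull_le_nonNumber_kIdeal_solecki : covOmegaNull ≤ nonNumber (kIdeal solecki) := by
  have hI := isProperIdeal_solecki
  obtain ⟨g, hg⟩ := exists_nullTransfer_from_real cantorSeqMeasure
  rw [hI.norms_kIdeal.1]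
  obtain ⟨F, hF, hc⟩ := exists_mk_eq_bNum
    (R := fun x (φ : {φ : ℕ → Set HalfClopen // ∀ n, φ n ∈ solecki}) => x ∈ kSet φ.1)
    fun φ => hI.exists_notMem_kSet φ.1 φ.2
  rw [← hc]
  refine le_trans (csInf_le' ⟨(fun x : ℕ → HalfClopen =>
      g ⁻¹' {y | ∃ᶠ n in atTop, ∀ i < n, y i ∉ (x n).1}) '' F, ?_, fun B hB => ?_, rfl⟩)
    Cardinal.mk_image_le
  · rintro _ ⟨x, -, rfl⟩
    exact hg _ (cantorSeqMeasure_frequently_avoid x)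
  -- Inserting 0 only ensures that the set is nonempty and can be enumerated.
  · obtain ⟨r, hr⟩ := (hB.insert 0).exists_eq_range (Set.insert_nonempty _ _)
    have hfin : ∀ n : ℕ, (⋃ k < n, ⋃ i < n, {g (r k) i}).Finite := fun n =>
      (Set.finite_lt_nat n).biUnion fun k _ => (Set.finite_lt_nat n).biUnion fun i _ =>
        Set.finite_singleton _
    obtain ⟨x, hx, hxF⟩ := hF ⟨fun n => {V | ∃ y ∈ ⋃ k < n, ⋃ i < n, {g (r k) i}, y ∈ V.1},
      fun n => mem_solecki.2 ⟨_, hfin n, fun V hV => hV⟩⟩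
    refine ⟨_, ⟨x, hx, rfl⟩, fun b hb => ?_⟩
    obtain ⟨k, rfl⟩ : b ∈ Set.range r := hr ▸ Set.mem_insert_of_mem _ hb
    by_contra hne
    refine hxF ?_
    filter_upwards [not_frequently.1 hne, eventually_gt_atTop k] with n hn hk
    push Not at hn
    obtain ⟨i, hi, hin⟩ := hn
    exact ⟨g (r k) i, by simp only [Set.mem_iUnion]; exact ⟨k, hk, i, hi, rfl⟩, hin⟩

theorem covNumber_kIdeal_solecki_le_nonNumber_nullIdeal :
    covNumber (kIdeal solecki) ≤ nonNumber nullIdeal := by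
  have hI := isProperIdeal_solecki
  obtain ⟨g, hg⟩ := exists_nullTransfer_from_real cantorSeqMeasure
  obtain ⟨A, hA, hc⟩ : nonNumber nullIdeal ∈ {κ | ∃ A : Set ℝ, A ∉ nullIdeal ∧ Cardinal.mk A = κ} :=
    csInf_mem ⟨_, Set.univ, by simp [nullIdeal], rfl⟩
  rw [hI.norms_kIdeal.2, ← hc]
  let φ : ℝ → {φ : ℕ → Set HalfClopen // ∀ n, φ n ∈ solecki} := fun r =>
    ⟨fun n => {V | ∃ y ∈ ⋃ i < n, {g r i}, y ∈ V.1}, fun n => mem_solecki.2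
      ⟨_, (Set.finite_lt_nat n).biUnion fun i _ => Set.finite_singleton _, fun V hV => hV⟩⟩
  refine (dNum_le_mk (D := φ '' A) fun x => ?_).trans Cardinal.mk_image_le
  by_contra! h
  refine hA (measure_mono_null (fun r hr => ?_) (hg _ (cantorSeqMeasure_frequently_avoid x)))
  by_contra hne
  refine h (φ r) ⟨r, hr, rfl⟩ ?_
  filter_upwards [not_frequently.1 hne] with n hn
  push Not at hn
  obtain ⟨i, hi, hin⟩ := hn
  exact ⟨g r i, by simp only [Set.mem_iUnion]; exact ⟨i, hi, rfl⟩, hin⟩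

theorem solecki_invariants :
    nonNumber (millerNull solecki) = max boundingNumber covOmegaNull ∧
      nonNumber (kIdeal solecki) = max boundingNumber covOmegaNull ∧
      covNumber (millerNull solecki) = min dominatingNumber (nonNumber nullIdeal) ∧
      covNumber (kIdeal solecki) = min dominatingNumber (nonNumber nullIdeal) := by
  have hI := isProperIdeal_solecki
  have h1 := nonNumber_millerNull_solecki_le
  have h2 := hI.nonNumber_kIdeal_le
  have h3 : max boundingNumber covOmegaNull ≤ nonNumber (kIdeal solecki) :=
    max_le hI.boundingNumber_le covOmegaNull_le_nonNumber_kIdeal_solecki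
  have h4 := le_covNumber_millerNull_solecki
  have h5 := hI.covNumber_millerNull_le
  have h6 : covNumber (kIdeal solecki) ≤ min dominatingNumber (nonNumber nullIdeal) :=
    le_min hI.covNumber_le_dominatingNumber covNumber_kIdeal_solecki_le_nonNumber_nullIdeal
  exact ⟨h1.antisymm (h3.trans h2), (h2.trans h1).antisymm h3, (h5.trans h6).antisymm h4,
    h6.antisymm (h4.trans h5)⟩

/-! ## The density zero ideal -/

theorem isProperIdeal_densityZero : IsProperIdeal densityZero where
  subset A hA B hB := by
    refine squeeze_zero (fun n => by positivity) (fun n => ?_) hA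
    gcongr
    exact (Set.finite_Iio n).inter_of_right A
  union A hA B hB := by
    have h : Tendsto _ atTop (𝓝 ((0 : ℝ) + 0)) := Tendsto.add hA hB
    rw [add_zero] at h
    refine squeeze_zero (fun n => by positivity) (fun n => ?_) h
    rw [← add_div, Set.union_inter_distrib_right]
    gcongr
    exact_mod_cast Set.ncard_union_le _ _
  finite A hA := by
    refine squeeze_zero (fun n => by positivity) (fun n => ?_)
      (tendsto_const_div_atTop_nhds_zero_nat (A.ncard : ℝ))
    gcongr
    exact Set.inter_subset_left
  univ h := by
    have h1 : Tendsto (fun n : ℕ => ((Set.univ ∩ Set.Iio n : Set ℕ).ncard : ℝ) / n) atTop (𝓝 1) := by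
      refine tendsto_const_nhds.congr' ?_
      filter_upwards [eventually_gt_atTop 0] with n hn
      have : (Set.Iio n).ncard = n := by
        rw [← Finset.coe_Iio, Set.ncard_coe_finset, Nat.card_Iio]
      rw [Set.univ_inter, this, div_self (by positivity)]
    exact zero_ne_one (tendsto_nhds_unique h h1)

open scoped Classical in
/-- The part of `A` in the dyadic block `[2 ^ m, 2 ^ (m + 1))`, shifted to the origin. -/
noncomputable def dyadicPart (A : Set ℕ) (m : ℕ) : Finset ℕ :=
  (Finset.range (2 ^ m)).filter fun j => 2 ^ m + j ∈ A

theorem mem_dyadicPart {A : Set ℕ} {m j : ℕ} :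
    j ∈ dyadicPart A m ↔ j < 2 ^ m ∧ 2 ^ m + j ∈ A := by
  simp [dyadicPart]

theorem tendsto_dyadicPart {A : Set ℕ} (hA : A ∈ densityZero) :
    Tendsto (fun m => ((dyadicPart A m).card : ℝ) / 2 ^ m) atTop (𝓝 0) := by
  have h1 : Tendsto (fun m : ℕ => 2 ^ (m + 1)) atTop (atTop : Filter ℕ) :=
    (tendsto_pow_atTop_atTop_of_one_lt one_lt_two).comp (tendsto_add_atTop_nat 1)
  have h2 := (Tendsto.comp hA h1).const_mul 2
  rw [mul_zero] at h2
  refine squeeze_zero (fun n => by positivity) (fun m => ?_) h2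
  have h3 : (dyadicPart A m).card ≤ (A ∩ Set.Iio (2 ^ (m + 1))).ncard := by
    rw [← Set.ncard_coe_finset, ← Set.ncard_image_of_injective _ (add_right_injective (2 ^ m))]
    refine Set.ncard_le_ncard ?_ ((Set.finite_Iio _).inter_of_right A)
    rintro _ ⟨j, hj, rfl⟩
    obtain ⟨h, h'⟩ := mem_dyadicPart.1 hj
    exact ⟨h', by simp only [Set.mem_Iio, pow_succ]; omega⟩
  have h4 : ((dyadicPart A m).card : ℝ) ≤ (A ∩ Set.Iio (2 ^ (m + 1))).ncard := by exact_mod_cast h3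
  simp only [Function.comp_apply]
  push_cast
  calc ((dyadicPart A m).card : ℝ) / 2 ^ m
      ≤ ((A ∩ Set.Iio (2 ^ (m + 1))).ncard : ℝ) / 2 ^ m := by gcongr
    _ = _ := by rw [pow_succ (2 : ℝ)]; field_simp

theorem ncard_inter_Iio_two_pow_succ_le (A : Set ℕ) (m : ℕ) :
    (A ∩ Set.Iio (2 ^ (m + 1))).ncard ≤ (A ∩ Set.Iio (2 ^ m)).ncard + (dyadicPart A m).card := by
  have h : A ∩ Set.Iio (2 ^ (m + 1)) ⊆
      (A ∩ Set.Iio (2 ^ m)) ∪ (fun j => 2 ^ m + j) '' (dyadicPart A m) := by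
    rintro k ⟨hk, hlt⟩
    simp only [Set.mem_Iio, pow_succ] at hlt
    rcases lt_or_ge k (2 ^ m) with h | h
    · exact Or.inl ⟨hk, h⟩
    · have e : 2 ^ m + (k - 2 ^ m) = k := by omega
      exact Or.inr ⟨k - 2 ^ m, mem_dyadicPart.2 ⟨by omega, by rwa [e]⟩, e⟩
  refine (Set.ncard_le_ncard h (((Set.finite_Iio _).inter_of_right A).union
    ((Finset.finite_toSet _).image _))).trans ((Set.ncard_union_le _ _).trans ?_)
  rw [Set.ncard_image_of_injective _ (add_right_injective (2 ^ m)), Set.ncard_coe_finset]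

/-- Past block `M` every block has relative size below ε/4. Summing geometrically, the blocks
contribute at most ε/4 of the next power of two, hence ε/2 of `n`, and the initial part 2 ^ M falls
below ε/4 of `n`. -/
theorem mem_densityZero_of_tendsto_dyadicPart {A : Set ℕ}
    (h : Tendsto (fun m => ((dyadicPart A m).card : ℝ) / 2 ^ m) atTop (𝓝 0)) :
    A ∈ densityZero := by
  refine Metric.tendsto_atTop.2 fun ε hε => ?_
  obtain ⟨M, hM⟩ := eventually_atTop.1 (h.eventually (gt_mem_nhds (show 0 < ε / 4 by positivity)))
  have key : ∀ j, ((A ∩ Set.Iio (2 ^ (M + j))).ncard : ℝ) ≤ 2 ^ M + ε / 4 * 2 ^ (M + j) := by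
    intro j
    induction j with
    | zero =>
      have : (A ∩ Set.Iio (2 ^ M)).ncard ≤ 2 ^ M := by
        refine (Set.ncard_le_ncard Set.inter_subset_right (Set.finite_Iio _)).trans ?_
        rw [← Finset.coe_Iio, Set.ncard_coe_finset, Nat.card_Iio]
      have h1 : ((A ∩ Set.Iio (2 ^ M)).ncard : ℝ) ≤ 2 ^ M := by exact_mod_cast this
      have : 0 ≤ ε / 4 * 2 ^ (M + 0) := by positivity
      rw [add_zero] at *
      linarith
    | succ j ih =>
      have h1 : ((A ∩ Set.Iio (2 ^ (M + j + 1))).ncard : ℝ) ≤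
          (A ∩ Set.Iio (2 ^ (M + j))).ncard + (dyadicPart A (M + j)).card := by
        exact_mod_cast ncard_inter_Iio_two_pow_succ_le A (M + j)
      have h2 := hM (M + j) (by omega)
      rw [div_lt_iff₀ (by positivity)] at h2
      rw [← add_assoc, pow_succ (2 : ℝ)]
      linarith
  obtain ⟨N, hN⟩ := exists_nat_gt (2 ^ M / (ε / 4))
  refine ⟨max N (2 ^ M), fun n hn => ?_⟩
  have hn0 : 0 < n := lt_of_lt_of_le (by positivity) ((le_max_right _ _).trans hn)
  obtain ⟨j, hj⟩ : ∃ j, Nat.log 2 n = M + j := by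
    have : M ≤ Nat.log 2 n := Nat.le_log_of_pow_le one_lt_two ((le_max_right _ _).trans hn)
    exact ⟨Nat.log 2 n - M, by omega⟩
  have hlt : n < 2 ^ (M + (j + 1)) := by
    have := Nat.lt_pow_succ_log_self one_lt_two n
    rwa [hj] at this
  have hle : 2 ^ (M + j) ≤ n := hj ▸ Nat.pow_log_le_self 2 hn0.ne'
  have h1 : ((A ∩ Set.Iio n).ncard : ℝ) ≤ (A ∩ Set.Iio (2 ^ (M + (j + 1)))).ncard := by
    exact_mod_cast Set.ncard_le_ncard (Set.inter_subset_inter_right _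
      (Set.Iio_subset_Iio hlt.le)) ((Set.finite_Iio _).inter_of_right A)
  have h2 := key (j + 1)
  rw [show (2 : ℝ) ^ (M + (j + 1)) = 2 ^ (M + j + 1) by rw [add_assoc]] at h2
  have h3 : (2 : ℝ) ^ (M + j) ≤ n := by exact_mod_cast hle
  have h4 : (N : ℝ) ≤ n := by exact_mod_cast (le_max_left _ _).trans hn
  have h5 : (2 : ℝ) ^ M < ε / 4 * n := by
    rw [div_lt_iff₀ (by positivity)] at hN
    nlinarith
  have hnpos : (0 : ℝ) < n := by exact_mod_cast hn0
  rw [Real.dist_eq, sub_zero, abs_of_nonneg (by positivity), div_lt_iff₀ hnpos]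
  rw [pow_succ (2 : ℝ)] at h2
  have h6 : ε / 4 * (2 ^ (M + j) * 2) ≤ ε / 2 * n := by nlinarith
  have h7 : 0 < ε * n := by positivity
  linarith

/-! ### From closed null sets to Miller null sets -/

/-- The binary digits of `k` below the leading one (a single digit for `k = 0, 1`). -/
def binCode (k : ℕ) : List Bool :=
  -- The maximum with 1 keeps every code nonempty, so that concatenating infinitely many codes gives
  -- an infinite sequence.
  List.ofFn fun i : Fin (max 1 (Nat.log 2 k)) => (k - 2 ^ Nat.log 2 k).testBit i

theorem one_le_length_binCode (k : ℕ) : 1 ≤ (binCode k).length := by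
  simp [binCode]

theorem log_two_pow_add {m j : ℕ} (hj : j < 2 ^ m) : Nat.log 2 (2 ^ m + j) = m :=
  (Nat.log_eq_iff (Or.inr ⟨one_lt_two, by positivity⟩)).2 ⟨by omega, by rw [pow_succ]; omega⟩

theorem length_binCode {m j : ℕ} (hm : 1 ≤ m) (hj : j < 2 ^ m) :
    (binCode (2 ^ m + j)).length = m := by
  simp [binCode, log_two_pow_add hj, hm]

theorem getD_binCode {m j i : ℕ} (hj : j < 2 ^ m) (hi : i < m) :
    (binCode (2 ^ m + j)).getD i false = j.testBit i := by
  have h : i = 0 ∨ i < m := Or.inr hi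
  simp [binCode, List.getD, log_two_pow_add hj, h]

/-- The concatenation of the codes of the entries of `s`. -/
def concatCode (s : List ℕ) : List Bool := s.flatMap binCode

theorem concatCode_append (s : List ℕ) (k : ℕ) :
    concatCode (s ++ [k]) = concatCode s ++ binCode k := by
  simp [concatCode]

/-- The point of the Cantor space obtained by concatenating the codes of the entries of `x`. -/
def codePoint (x : ℕ → ℕ) (j : ℕ) : Bool := (concatCode (initSeg x (j + 1))).getD j false

/-- This shows that `codePoint` never reads the default value. -/
theorem le_length_concatCode (x : ℕ → ℕ) (n : ℕ) : n ≤ (concatCode (initSeg x n)).length := by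
  induction n with
  | zero => simp
  | succ n ih =>
    rw [initSeg_succ, concatCode_append, List.length_append]
    have := one_le_length_binCode (x n)
    omega

theorem concatCode_prefix (x : ℕ → ℕ) {m n : ℕ} (h : m ≤ n) :
    concatCode (initSeg x m) <+: concatCode (initSeg x n) := by
  induction n, h using Nat.le_induction with
  | base => exact List.prefix_rfl
  | succ n _ ih =>
    rw [initSeg_succ, concatCode_append]
    exact ih.trans (List.prefix_append _ _)

theorem getD_of_prefix {s t : List Bool} (h : s <+: t) {i : ℕ} (hi : i < s.length) :
    t.getD i false = s.getD i false := by
  obtain ⟨r, rfl⟩ := h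
  rw [List.getD_append _ _ _ _ hi]

theorem codePoint_eq (x : ℕ → ℕ) {n i : ℕ} (hi : i < (concatCode (initSeg x n)).length) :
    codePoint x i = (concatCode (initSeg x n)).getD i false := by
  have hi' : i < (concatCode (initSeg x (i + 1))).length := le_length_concatCode x (i + 1)
  rcases le_total (i + 1) n with h | h
  · exact (getD_of_prefix (concatCode_prefix x h) hi').symm
  · exact getD_of_prefix (concatCode_prefix x h) hi

/-- `φ s` consists of those `k` for which the code of `s` followed by `k` is a node of the tree of
`C`. Within a dyadic block these `k` inject into one level of the tree, whose proportion of nodes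
tends to zero. -/
theorem exists_miller_of_closed_null {C : Set (ℕ → Bool)} (hC : IsClosed C)
    (h0 : cantorMeasure C = 0) : ∃ φ : {φ : List ℕ → Set ℕ // ∀ s, φ s ∈ densityZero},
      ∀ x, codePoint x ∈ C → x ∈ millerSet φ.1 := by
  classical
  refine ⟨⟨fun s => {k | ∃ y ∈ C, ∀ i < (concatCode (s ++ [k])).length,
    y i = (concatCode (s ++ [k])).getD i false}, fun s => ?_⟩, fun x hx => ?_⟩
  · refine mem_densityZero_of_tendsto_dyadicPart ?_
    set L := (concatCode s).length
    have hlim := (ENNReal.tendsto_toReal ENNReal.zero_ne_top).comp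
      ((tendsto_cantorMeasure_tree hC h0).comp (tendsto_add_atTop_nat L))
    -- Block `m` has 2 ^ m elements while level `m + L` has 2 ^ (m + L) nodes; this costs the factor
    -- 2 ^ L, fixed with `s`.
    have hlim2 := hlim.const_mul (2 ^ L)
    rw [ENNReal.toReal_zero, mul_zero] at hlim2
    refine squeeze_zero' (Eventually.of_forall fun n => by positivity) ?_ hlim2
    filter_upwards [eventually_ge_atTop 1] with m hm
    simp only [Function.comp_apply]
    have hfin : (restr (m + L) '' C).Finite := Set.toFinite _
    rw [← hfin.coe_toFinset, cantorMeasure_restr]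
    have hcard : (dyadicPart {k | ∃ y ∈ C, ∀ i < (concatCode (s ++ [k])).length,
        y i = (concatCode (s ++ [k])).getD i false} m).card ≤ hfin.toFinset.card := by
      refine Finset.card_le_card_of_injOn
        (fun j i => (concatCode (s ++ [2 ^ m + j])).getD i false) ?_ ?_
      · intro j hj
        obtain ⟨hjm, y, hy, hyi⟩ := mem_dyadicPart.1 hj
        refine hfin.mem_toFinset.2 ⟨y, hy, funext fun i => hyi i ?_⟩
        rw [concatCode_append, List.length_append, length_binCode hm hjm]
        have := i.2
        omega
      · intro j hj j' hj' hjj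
        have h1 := (mem_dyadicPart.1 hj).1
        have h2 := (mem_dyadicPart.1 hj').1
        refine Nat.eq_of_testBit_eq fun i => ?_
        rcases lt_or_ge i m with hi | hi
        · have := congrFun hjj ⟨L + i, by omega⟩
          simp only [concatCode_append] at this
          rw [List.getD_append_right _ _ _ _ (by omega), List.getD_append_right _ _ _ _ (by omega),
            show L + i - (concatCode s).length = i by omega, getD_binCode h1 hi,
            getD_binCode h2 hi] at this
          exact this
        · have hp : 2 ^ m ≤ 2 ^ i := Nat.pow_le_pow_right (by norm_num) hi
          rw [Nat.testBit_lt_two_pow (h1.trans_le hp), Nat.testBit_lt_two_pow (h2.trans_le hp)]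
    have hcard' : ((dyadicPart {k | ∃ y ∈ C, ∀ i < (concatCode (s ++ [k])).length,
        y i = (concatCode (s ++ [k])).getD i false} m).card : ℝ) ≤ hfin.toFinset.card := by
      exact_mod_cast hcard
    simp only [ENNReal.toReal_mul, ENNReal.toReal_pow, ENNReal.toReal_inv, ENNReal.toReal_natCast,
      ENNReal.toReal_ofNat, inv_pow]
    rw [div_le_iff₀ (by positivity), pow_add]
    refine hcard'.trans (le_of_eq ?_)
    field_simp
  · refine Eventually.of_forall fun n => ⟨codePoint x, hx, fun i hi => ?_⟩
    rw [← initSeg_succ] at hi ⊢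
    exact codePoint_eq x hi

theorem exists_miller_of_mem_closedNullIdeal {A : Set (ℕ → Bool)} (hA : A ∈ closedNullIdeal) :
    ∃ φ : {φ : List ℕ → Set ℕ // ∀ s, φ s ∈ densityZero},
      ∀ x, codePoint x ∈ A → x ∈ millerSet φ.1 := by
  obtain ⟨F, hF, hc, hA⟩ := hA
  have hF' : ∅ ∈ {C : Set (ℕ → Bool) | IsClosed C ∧ cantorMeasure C = 0} := by simp
  obtain ⟨C, hC⟩ := (hc.insert ∅).exists_eq_range (Set.insert_nonempty _ _)
  have hCn : ∀ n, IsClosed (C n) ∧ cantorMeasure (C n) = 0 := fun n =>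
    Set.insert_subset hF' hF (hC ▸ ⟨n, rfl⟩)
  choose c hc using fun n => exists_miller_of_closed_null (hCn n).1 (hCn n).2
  obtain ⟨φ, hφ⟩ := isProperIdeal_densityZero.exists_millerSet_absorbing c
  refine ⟨φ, fun x hx => ?_⟩
  obtain ⟨B, hB, hxB⟩ := hA hx
  obtain ⟨n, rfl⟩ : B ∈ Set.range C := hC ▸ Set.mem_insert_of_mem _ hB
  exact hφ n (hc n x hxB)

theorem nonNumber_closedNullIdeal_le :
    nonNumber closedNullIdeal ≤ nonNumber (millerNull densityZero) := by
  have hI := isProperIdeal_densityZero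
  choose ψ hψ using fun A : closedNullIdeal => exists_miller_of_mem_closedNullIdeal A.2
  rw [hI.norms_millerNull.1, closedNullIdeal, nonNumber_eq_bNum sigmaIdealGen_mono]
  exact bNum_le_of_tukey codePoint ψ (fun x A h => hψ A x h)
    fun φ => hI.exists_notMem_millerSet φ.1 φ.2

theorem covNumber_millerNull_densityZero_le :
    covNumber (millerNull densityZero) ≤ covNumber closedNullIdeal := by
  have hI := isProperIdeal_densityZero
  choose ψ hψ using fun A : closedNullIdeal => exists_miller_of_mem_closedNullIdeal A.2
  rw [hI.norms_millerNull.2.1, covNumber_eq_dNum]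
  exact dNum_le_of_tukey codePoint ψ (fun x A h => hψ A x h) fun z =>
    ⟨⟨{z}, mem_sigmaIdealGen ⟨isClosed_singleton,
      cantorMeasure_countable (Set.countable_singleton z)⟩⟩, rfl⟩

/-! ### From Miller null sets to closed null sets -/

theorem binVal_congr {y z : ℕ → Bool} {n : ℕ} (h : ∀ i < n, y i = z i) :
    binVal y n = binVal z n := by
  induction n with
  | zero => rfl
  | succ n ih =>
    rw [binVal, binVal, ih fun i hi => h i (by omega), h n (by omega)]

theorem binVal_lt (z : ℕ → Bool) (n : ℕ) : binVal z n < 2 ^ n := by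
  induction n with
  | zero => simp [binVal]
  | succ n ih =>
    have := Bool.toNat_lt (z n)
    rw [binVal, pow_succ]
    omega

theorem cantorMeasure_block_le {L m : ℕ} (s : Fin L → Bool) (k : ℕ) :
    cantorMeasure {z | restr L z = s ∧ binVal (fun j => z (L + j)) m = k} ≤ 2⁻¹ ^ (L + m) := by
  rcases Set.eq_empty_or_nonempty {z | restr L z = s ∧ binVal (fun j => z (L + j)) m = k} with
    h | ⟨y, hy, hyk⟩
  · simp [h]
  · rw [← cantorMeasure_restr_singleton (restr (L + m) y)]
    refine measure_mono fun z ⟨hz, hzk⟩ => restr_eq_restr.2 fun i hi => ?_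
    rcases lt_or_ge i L with h | h
    · exact restr_eq_restr.1 (hz.trans hy.symm) i h
    · have := eq_of_binVal_eq (hzk.trans hyk.symm) (i - L) (by omega)
      rwa [Nat.add_sub_cancel' h] at this

/-- Restricting the next block of `m` digits to at most half of its values, depending on the
previous digits, halves the measure. -/
theorem cantorMeasure_halving {L m : ℕ} {E : Set (ℕ → Bool)} {K : (ℕ → Bool) → Finset ℕ}
    (hE : ∀ y z, restr L y = restr L z → y ∈ E → z ∈ E)
    (hK : ∀ y z, restr L y = restr L z → K y = K z) (hcard : ∀ z, 2 * (K z).card ≤ 2 ^ m) :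
    cantorMeasure {z | z ∈ E ∧ binVal (fun j => z (L + j)) m ∈ K z} ≤ 2⁻¹ * cantorMeasure E := by
  classical
  let S : Finset (Fin L → Bool) := (Set.toFinite (restr L '' E)).toFinset
  have hES : E = restr L ⁻¹' S := by
    ext z
    simp only [S, Set.Finite.coe_toFinset, Set.mem_preimage]
    exact ⟨fun hz => ⟨z, hz, rfl⟩, fun ⟨y, hy, h⟩ => hE y z h hy⟩
  have hsub : {z | z ∈ E ∧ binVal (fun j => z (L + j)) m ∈ K z} ⊆ ⋃ s ∈ S,
      {z | restr L z = s ∧ binVal (fun j => z (L + j)) m ∈ K z} := fun z ⟨hz, hzK⟩ => by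
    simp only [Set.mem_iUnion]
    exact ⟨restr L z, by rw [hES] at hz; exact hz, rfl, hzK⟩
  have hs : ∀ s, cantorMeasure {z | restr L z = s ∧ binVal (fun j => z (L + j)) m ∈ K z} ≤
      2⁻¹ * 2⁻¹ ^ L := by
    intro s
    rcases Set.eq_empty_or_nonempty
      {z | restr L z = s ∧ binVal (fun j => z (L + j)) m ∈ K z} with h | ⟨y, hy, -⟩
    · simp [h]
    have hsub' : {z | restr L z = s ∧ binVal (fun j => z (L + j)) m ∈ K z} ⊆
        ⋃ k ∈ K y, {z | restr L z = s ∧ binVal (fun j => z (L + j)) m = k} := fun z ⟨hz, hzK⟩ => by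
      simp only [Set.mem_iUnion]
      exact ⟨_, hK z y (hz.trans hy.symm) ▸ hzK, hz, rfl⟩
    refine (measure_mono hsub').trans ((measure_biUnion_finset_le _ _).trans
      ((Finset.sum_le_card_nsmul _ _ _ fun k _ => cantorMeasure_block_le s k).trans ?_))
    rw [nsmul_eq_mul, pow_add]
    have h2 : ((K y).card : ENNReal) ≤ 2⁻¹ * 2 ^ m := by
      have : (2 * (K y).card : ENNReal) ≤ 2 ^ m := by exact_mod_cast hcard y
      calc ((K y).card : ENNReal) = 2⁻¹ * (2 * (K y).card) := by
            rw [← mul_assoc, ENNReal.inv_mul_cancel (by norm_num) (by norm_num), one_mul]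
        _ ≤ _ := by gcongr
    calc ((K y).card : ENNReal) * (2⁻¹ ^ L * 2⁻¹ ^ m)
        ≤ (2⁻¹ * 2 ^ m) * (2⁻¹ ^ L * 2⁻¹ ^ m) := by gcongr
      _ = 2⁻¹ * 2⁻¹ ^ L * (2⁻¹ ^ m * 2 ^ m) := by ring
      _ = _ := by rw [inv_two_pow_mul_two_pow, mul_one]
  refine (measure_mono hsub).trans ((measure_biUnion_finset_le _ _).trans
    ((Finset.sum_le_card_nsmul _ _ _ fun s _ => hs s).trans_eq ?_))
  rw [hES, cantorMeasure_restr, nsmul_eq_mul]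
  ring

/-- The sequence of natural numbers whose `n`-th entry has the `n`-th block of `z`, of length `f n`,
as its binary digits below the leading one. -/
def blockSeq (f : ℕ → ℕ) (z : ℕ → Bool) (n : ℕ) : ℕ :=
  2 ^ f n + binVal (fun j => z (∑ i ∈ Finset.range n, f i + j)) (f n)

theorem blockSeq_lt (f : ℕ → ℕ) (z : ℕ → Bool) (n : ℕ) : blockSeq f z n < 2 ^ (f n + 1) := by
  have := binVal_lt (fun j => z (∑ i ∈ Finset.range n, f i + j)) (f n)
  rw [blockSeq, pow_succ]
  omega

theorem blockSeq_congr {f : ℕ → ℕ} {y z : ℕ → Bool} {n : ℕ}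
    (h : restr (∑ i ∈ Finset.range (n + 1), f i) y = restr (∑ i ∈ Finset.range (n + 1), f i) z) :
    blockSeq f y n = blockSeq f z n := by
  rw [restr_eq_restr, Finset.sum_range_succ] at h
  rw [blockSeq, blockSeq, binVal_congr fun j hj => h _ (by omega)]

theorem restr_mono {m n : ℕ} (h : m ≤ n) {y z : ℕ → Bool} (hyz : restr n y = restr n z) :
    restr m y = restr m z :=
  restr_eq_restr.2 fun i hi => restr_eq_restr.1 hyz i (hi.trans_le h)

theorem initSeg_blockSeq_congr {f : ℕ → ℕ} {y z : ℕ → Bool} {n : ℕ}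
    (h : restr (∑ i ∈ Finset.range n, f i) y = restr (∑ i ∈ Finset.range n, f i) z) :
    initSeg (blockSeq f y) n = initSeg (blockSeq f z) n :=
  initSeg_congr fun i hi => blockSeq_congr (restr_mono
    (Finset.sum_le_sum_of_subset (Finset.range_subset_range.2 (by omega))) h)

theorem finite_bounded_lists (n N : ℕ) : {s : List ℕ | s.length = n ∧ ∀ a ∈ s, a < N}.Finite := by
  refine ((List.finite_length_eq (Fin N) n).image (List.map Fin.val)).subset ?_
  rintro s ⟨hs, hN⟩
  exact ⟨s.pmap Fin.mk hN, by simpa using hs, by simp [List.map_pmap]⟩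

theorem mem_initSeg {X : Type} {x : ℕ → X} {n : ℕ} {a : X} :
    a ∈ initSeg x n ↔ ∃ i < n, x i = a := by
  simp only [initSeg, List.mem_ofFn]
  exact ⟨fun ⟨i, h⟩ => ⟨i, i.2, h⟩, fun ⟨i, hi, h⟩ => ⟨⟨i, hi⟩, h⟩⟩

/-- The block lengths escaping a suitable predictor make the preimage of a Miller null set small. -/
theorem exists_predictor_closedNull (φ : List ℕ → Set ℕ) (hφ : ∀ s, φ s ∈ densityZero) :
    ∃ π : List ℕ → ℕ, ∀ f : ℕ → ℕ, (∃ᶠ n in atTop, π (initSeg f n) < f n) →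
      {z | blockSeq f z ∈ millerSet φ} ∈ closedNullIdeal := by
  have hg : ∀ s, ∃ M, ∀ m, M ≤ m → 2 * (dyadicPart (φ s) m).card ≤ 2 ^ m := by
    intro s
    obtain ⟨M, hM⟩ := eventually_atTop.1
      ((tendsto_dyadicPart (hφ s)).eventually (gt_mem_nhds (show (0 : ℝ) < 1 / 2 by norm_num)))
    refine ⟨M, fun m hm => ?_⟩
    have := hM m hm
    rw [div_lt_iff₀ (by positivity)] at this
    have h : (2 * (dyadicPart (φ s) m).card : ℝ) ≤ 2 ^ m := by linarith
    exact_mod_cast h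
  choose g hg using hg
  -- The predictor knows the previous block lengths `t` but not `z`. The lengths bound all entries,
  -- leaving finitely many histories, and the largest threshold `g` among them works for every `z`
  -- at once.
  refine ⟨fun t => (finite_bounded_lists t.length (2 ^ (t.sum + 1))).toFinset.sup g,
    fun f hf => ?_⟩
  have hgood : ∃ᶠ n in atTop, ∀ z, g (initSeg (blockSeq f z) n) ≤ f n := by
    refine hf.mono fun n hn z => (le_trans ?_ hn.le)
    refine Finset.le_sup ((Set.Finite.mem_toFinset _).2 ⟨by simp, fun a ha => ?_⟩)
    obtain ⟨i, hi, rfl⟩ := mem_initSeg.1 ha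
    refine (blockSeq_lt f z i).trans_le (Nat.pow_le_pow_right (by norm_num) ?_)
    exact Nat.add_le_add_right (List.le_sum_of_mem (mem_initSeg.2 ⟨i, hi, rfl⟩)) 1
  let D : ℕ → Set (ℕ → Bool) := fun n => {z | blockSeq f z n ∈ φ (initSeg (blockSeq f z) n)}
  have hD : ∀ n y z, restr (∑ i ∈ Finset.range (n + 1), f i) y =
      restr (∑ i ∈ Finset.range (n + 1), f i) z → y ∈ D n → z ∈ D n := by
    intro n y z h hy
    have h1 := initSeg_blockSeq_congr (n := n) (restr_mono
      (Finset.sum_le_sum_of_subset (Finset.range_subset_range.2 (by omega))) h)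
    have h2 := blockSeq_congr h
    simp only [D, Set.mem_ofPred_eq] at hy ⊢
    rwa [← h1, ← h2]
  have hDc : ∀ n, IsClosed (D n) := by
    intro n
    have : D n = restr (∑ i ∈ Finset.range (n + 1), f i) ⁻¹'
        (restr (∑ i ∈ Finset.range (n + 1), f i) '' D n) :=
      (Set.subset_preimage_image _ _).antisymm fun z ⟨y, hy, h⟩ => hD n y z h hy
    rw [this]
    exact (isClosed_discrete _).preimage (continuous_restr _)
  let E : ℕ → ℕ → Set (ℕ → Bool) := fun N n => {z | ∀ i, N ≤ i → i < n → z ∈ D i}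
  have hE : ∀ N n y z, restr (∑ i ∈ Finset.range n, f i) y =
      restr (∑ i ∈ Finset.range n, f i) z → y ∈ E N n → z ∈ E N n := fun N n y z h hy i hNi hin =>
    hD i y z (restr_mono (Finset.sum_le_sum_of_subset (Finset.range_subset_range.2 hin)) h)
      (hy i hNi hin)
  have hhalf : ∀ N n, N ≤ n → (∀ z, g (initSeg (blockSeq f z) n) ≤ f n) →
      cantorMeasure (E N (n + 1)) ≤ 2⁻¹ * cantorMeasure (E N n) := by
    intro N n hNn hn
    refine (measure_mono fun z hz => ?_).trans (cantorMeasure_halving (hE N n)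
      (K := fun z => dyadicPart (φ (initSeg (blockSeq f z) n)) (f n))
      (fun y z h => by rw [initSeg_blockSeq_congr h]) fun z => hg _ _ (hn z))
    exact ⟨fun i h1 h2 => hz i h1 (by omega), mem_dyadicPart.2 ⟨binVal_lt _ _,
      hz n hNn (by omega)⟩⟩
  -- Each good index halves the measure, and there are infinitely many of them.
  have hsmall : ∀ N k : ℕ, ∃ n, N ≤ n ∧ cantorMeasure (E N n) ≤ 2⁻¹ ^ k := by
    intro N k
    induction k with
    | zero => exact ⟨N, le_rfl, by simpa using prob_le_one⟩
    | succ k ih =>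
      obtain ⟨n, hNn, hn⟩ := ih
      obtain ⟨n', hn', hgn⟩ := frequently_atTop.1 hgood n
      refine ⟨n' + 1, by omega, (hhalf N n' (by omega) hgn).trans ?_⟩
      rw [pow_succ']
      gcongr
      exact (measure_mono (show E N n' ⊆ E N n from fun z hz i h1 h2 => hz i h1 (by omega))).trans hn
  refine ⟨Set.range fun N => ⋂ n ≥ N, D n, ?_, Set.countable_range _, fun z hz => ?_⟩
  · rintro _ ⟨N, rfl⟩
    refine ⟨isClosed_biInter fun n _ => hDc n, ?_⟩
    have hlim : Tendsto (fun n : ℕ => (2⁻¹ : ENNReal) ^ n) atTop (𝓝 0) :=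
      ENNReal.tendsto_pow_atTop_nhds_zero_of_lt_one (by norm_num)
    refine nonpos_iff_eq_zero.1 (ge_of_tendsto' hlim fun k => ?_)
    obtain ⟨n, -, hn⟩ := hsmall N k
    exact (measure_mono (show ⋂ n ≥ N, D n ⊆ E N n from
      fun z hz i h1 _ => Set.mem_iInter₂.1 hz i h1)).trans hn
  · obtain ⟨N, hN⟩ := eventually_atTop.1 hz
    exact ⟨_, ⟨N, rfl⟩, Set.mem_iInter₂.2 hN⟩

theorem univ_notMem_closedNullIdeal : Set.univ ∉ closedNullIdeal := by
  rintro ⟨F, hF, hc, h⟩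
  have h0 : cantorMeasure (⋃₀ F) = 0 := (measure_sUnion_null_iff hc).2 fun C hC => (hF hC).2
  have := measure_mono_null h h0
  rw [measure_univ] at this
  exact one_ne_zero this

/-- Pairs of an escaping `f` and a point of a set outside 𝓔 suffice: if all their block sequences
stayed in one Miller set, a suitable `f` would put that set into 𝓔. -/
theorem nonNumber_millerNull_densityZero_le :
    nonNumber (millerNull densityZero) ≤ max boundingNumber (nonNumber closedNullIdeal) := by
  have hI := isProperIdeal_densityZero
  obtain ⟨F, hFc, hF⟩ := exists_escaping_family
  obtain ⟨Z, hZ, hZc⟩ : nonNumber closedNullIdeal ∈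
      {κ | ∃ A : Set (ℕ → Bool), A ∉ closedNullIdeal ∧ Cardinal.mk A = κ} :=
    csInf_mem ⟨_, Set.univ, univ_notMem_closedNullIdeal, rfl⟩
  rw [hI.norms_millerNull.1]
  refine (bNum_le_mk (F := Set.range fun p : F × Z => blockSeq p.1.1 p.2.1)
    fun φ => ?_).trans (Cardinal.mk_range_le.trans ?_)
  · obtain ⟨π, hπ⟩ := exists_predictor_closedNull φ.1 φ.2
    obtain ⟨f, hf, hesc⟩ := hF π
    by_contra! h
    exact hZ (sigmaIdealGen_mono _ (hπ f hesc) Z fun z hz => h _ ⟨(⟨f, hf⟩, ⟨z, hz⟩), rfl⟩)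
  · rw [← Cardinal.mul_def, hFc, hZc]
    exact Cardinal.mul_le_max_of_aleph0_le_left aleph0_le_boundingNumber

theorem le_covNumber_millerNull_densityZero :
    min dominatingNumber (covNumber closedNullIdeal) ≤ covNumber (millerNull densityZero) := by
  have hI := isProperIdeal_densityZero
  rw [hI.norms_millerNull.2.1]
  obtain ⟨D, hD, hc⟩ := exists_mk_eq_dNum hI.exists_mem_millerSet
  rw [← hc]
  by_contra! hlt
  obtain ⟨hd, he⟩ := lt_min_iff.1 hlt
  choose π hπ using fun φ : D => exists_predictor_closedNull φ.1.1 φ.1.2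
  -- A single `f` escapes all predictors, so all preimages lie in 𝓔 at once and are too few to cover
  -- the space.
  obtain ⟨f, hf⟩ := exists_escaping_of_mk_lt π hd
  rw [covNumber_eq_dNum] at he
  obtain ⟨z, hz⟩ := exists_of_mk_lt_dNum (D := Set.range fun φ : D =>
    (⟨{z | blockSeq f z ∈ millerSet φ.1.1}, hπ φ f (hf φ)⟩ : closedNullIdeal))
    (Cardinal.mk_range_le.trans_lt he)
  obtain ⟨φ, hφ, hx⟩ := hD (blockSeq f z)
  exact hz _ ⟨⟨φ, hφ⟩, rfl⟩ hx

theorem densityZero_invariants :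
    nonNumber (millerNull densityZero) = max boundingNumber (nonNumber closedNullIdeal) ∧
      covNumber (millerNull densityZero) = min dominatingNumber (covNumber closedNullIdeal) := by
  have hI := isProperIdeal_densityZero
  exact ⟨nonNumber_millerNull_densityZero_le.antisymm
      (max_le (hI.boundingNumber_le.trans hI.nonNumber_kIdeal_le) nonNumber_closedNullIdeal_le),
    (le_min (hI.covNumber_millerNull_le.trans hI.covNumber_le_dominatingNumber)
      covNumber_millerNull_densityZero_le).antisymm le_covNumber_millerNull_densityZero⟩

end IdealInvariants

theorem theoremB :
    (nonNumber (millerNull finFin) = constBoundingEvasion 2 ∧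
      covNumber (millerNull finFin) = constBoundingPrediction 2 ∧
      nonNumber (kIdeal finFin) = boundingNumber ∧
      covNumber (kIdeal finFin) = dominatingNumber) ∧
    (nonNumber (millerNull solecki) = max boundingNumber covOmegaNull ∧
      nonNumber (kIdeal solecki) = max boundingNumber covOmegaNull ∧
      covNumber (millerNull solecki) = min dominatingNumber (nonNumber nullIdeal) ∧
      covNumber (kIdeal solecki) = min dominatingNumber (nonNumber nullIdeal)) ∧
    (nonNumber (millerNull densityZero) = max boundingNumber (nonNumber closedNullIdeal) ∧
      covNumber (millerNull densityZero) = min dominatingNumber (covNumber closedNullIdeal)) :=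
  ⟨⟨nonNumber_millerNull_finFin, covNumber_millerNull_finFin, nonNumber_kIdeal_finFin,
    covNumber_kIdeal_finFin⟩, solecki_invariants, densityZero_invariants⟩
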